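/- **Problem and operator.** Let $G=(\mathcal V,\mathcal E)$ be a finite graph. Each node $i$ carries a closed, proper, convex function $f_i:\mathbb R^{n_i}\to\mathbb R\cup\{+\infty\}$, and each edge carries constraints $A_{ij}x_i+A_{ji}x_j\preceq b_{ij}$, where any prescribed subset of the scalar rows may be equalities instead. Put $f(x)=\sum_i f_i(x_i)$ and consider minimising $f$ subject to all these constraints. Let $m$ be the total number of scalar constraints. For $z\in\mathbb R^{2m}$, with blocks $z_{i|j}$ and $z_{j|i}$ for every edge, let $C x$ have blocks $(Cx)_{i|j}=A_{ij}x_i$, let $d_{i|j}=\tfrac12 b_{ij}$, let $P$ swap the blocks $i|j$ and $j|i$, and let $M=\{\mu:\mu=P\mu,\ \mu\ge 0 \text{ on the inequality rows}\}$. Fix $c>0$, let $f^*$ be the convex conjugate of $f$, put $T_1(\mu)=-C\,\partial f^*(-C^T\mu)+d$ and $T_2=N_M$ (the normal cone of $M$). With $J_{cA}=(I+cA)^{-1}$ and $C_{cA}=2J_{cA}-I$, let $S=C_{cT_2}\circ C_{cT_1}$ be the IEQ-PDMM operator, and for $\alpha\in(0,1]$ let $T_\alpha=(1-\alpha)I+\alpha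 S$. An operator $T$ is $\alpha$-averaged if $\alpha\in(0,1)$ and $T=(1-\alpha)I+\alpha R$ for some nonexpansive $R$. The $x$-update at $z$ is the minimisation of $f(x)+z^TCx+\frac c2\|Cx-d\|^2$ over $x$. **Stochastic iteration.** Let $(U^{(k)})_{k\in\mathbb N}$ be i.i.d. random vectors with values in $\{0,1\}^{2m}$ (the entries of one vector may be dependent) such that every entry of $U^{(1)}$ equals $1$ with positive probability. For an operator $T$ on $\mathbb R^{2m}$ and any deterministic $z^{(0)}\in\mathbb R^{2m}$, put $Z^{(0)}=z^{(0)}$ and $Z^{(k+1)}=(I-U^{(k+1)})Z^{(k)}+U^{(k+1)}T(Z^{(k)})$, with $U^{(k+1)}$ acting as a diagonal matrix. **Claims.** 1. If $T$ is an $\alpha$-averaged operator on $\mathbb R^{2m}$ that has a fixed point, then $Z^{(k)}-T(Z^{(k)})\to0$ almost surely. 2. If every $x$-update ($z\in\mathbb R^{2m}$) has a minimiser and $S$ has a fixed point, then for every $\alpha\in(0,1)$ the operator $T_\alpha$ is $\alpha$-averaged, and the iteration with $T=T_\alpha$ satisfies $Z^{(k)}-T_\alpha(Z^{(k)})\to0$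 almost surely. 3. If $f$ is (finite and) differentiable and strongly convex, and the constraints are feasible, then every $x$-update has a unique minimiser and the constrained problem has a unique solution $x^*$. Moreover, for every $\alpha\in(0,1]$, in particular for $\alpha=1$, the iteration with $T=T_\alpha$ satisfies $X^{(k)}\to x^*$ almost surely, where $X^{(k+1)}$ is the minimiser of the $x$-update at $Z^{(k)}$. 4. The following masks satisfy all the assumptions made on $(U^{(k)})$, so that 1–3 apply to them: - (asynchronous updating) $U^{(k)}_{j|i}=1$ if $i\in\zeta^{(k)}$ and $0$ otherwise, where $(\zeta^{(k)})$ are i.i.d. random sets of nodes with $\mathcal P(i\in\zeta^{(1)})>0$ for every node $i$ that has a neighbour; - (transmission losses) $U^{(k)}_{j|i}=1$ if $(i,j)\in\eta^{(k)}$ and $0$ otherwise, where $(\eta^{(k)})$ are i.i.d. random sets of directed edges with $\mathcal P((i,j)\in\eta^{(1)})>0$ for every directed edge $(i,j)$; - (both) $U^{(k)}_{j|i}=1$ if $i\in\zeta^{(k)}$ and $(i,j)\in\eta^{(k)}$, and $0$ otherwise, where the pairs $(\zeta^{(k)},\eta^{(k)})$ are i.i.d. with $\mathcal P(i\in\zeta^{(1)},(i,j)\in\eta^{(1)})>0$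 for every directed edge $(i,j)$. -/

import Mathlib

open MeasureTheory ProbabilityTheory Filter Topology
open scoped RealInnerProductSpace

/-! ### Convex analysis and monotone operators -/

section Convex

variable {E : Type*} [NormedAddCommGroup E] [InnerProductSpace ℝ E]

/-- `f : E → ℝ ∪ {+∞}` is closed, proper and convex. -/
structure IsCCP (f : E → EReal) : Prop where
  closed : LowerSemicontinuous f
  ne_bot : ∀ x, f x ≠ ⊥
  proper : ∃ x, f x ≠ ⊤
  convex : Convex ℝ {p : E × ℝ | f p.1 ≤ (p.2 : EReal)}

/-- The convex conjugate `f*(y) = sup_x (⟪y, x⟫ - f x)`; points outside `dom f` contribute `-∞`. -/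
noncomputable def conjugate (f : E → EReal) (y : E) : EReal :=
  ⨆ x : E, ((⟪y, x⟫ : ℝ) : EReal) - f x

/-- The subdifferential of `g` at `y`. -/
def subdifferential (g : E → EReal) (y : E) : Set E :=
  {u | ∀ y' : E, g y + ((⟪u, y' - y⟫ : ℝ) : EReal) ≤ g y'}

/-- The normal cone of `M` at `μ` (empty if `μ ∉ M`). -/
def normalCone (M : Set E) (μ : E) : Set E :=
  {w | μ ∈ M ∧ ∀ u ∈ M, ⟪w, u - μ⟫ ≤ 0}

/-- The resolvent `J_{cA} = (I + cA)⁻¹` of a set-valued operator `A`: the point `p` with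
`z ∈ p + c A p` (such a `p` is unique when `A` is monotone and `0 < c`). -/
noncomputable def monResolvent (c : ℝ) (A : E → Set E) (z : E) : E :=
  Classical.epsilon fun p => ∃ u ∈ A p, z = p + c • u

/-- The Cayley operator `C_{cA} = 2 J_{cA} - I`. -/
noncomputable def cayley (c : ℝ) (A : E → Set E) (z : E) : E :=
  (2 : ℝ) • monResolvent c A z - z

/-- `T` is `α`-averaged: `α ∈ (0,1)` and `T = (1 - α) I + α R` with `R` nonexpansive. -/
def IsAveraged (α : ℝ) (T : E → E) : Prop :=
  0 < α ∧ α < 1 ∧ ∃ R : E → E, LipschitzWith 1 R ∧ ∀ z, T z = (1 - α) • z + α • R z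

end Convex

/-! ### The optimisation problem over a graph -/

/-- A separable problem over a graph `G` on `V`: node `v` carries a variable in `ℝ^(n v)` and a cost
`f v`; the edge `e = {i, j}` carries `mI e` inequality constraints and `mE e` equality constraints
`A e i x_i + A e j x_j ≤ b e`, resp. `= b e`. Thus `A e i` is the matrix usually written `A_{ij}`;
only the values `A e v` with `e` an edge and `v` an endpoint of `e` are ever used. -/
structure PDMMProblem (V : Type*) where
  G : SimpleGraph V
  n : V → ℕ
  mI : Sym2 V → ℕ
  mE : Sym2 V → ℕ
  A : (e : Sym2 V) → (v : V) → Matrix (Fin (mI e) ⊕ Fin (mE e)) (Fin (n v)) ℝ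
  b : (e : Sym2 V) → Fin (mI e) ⊕ Fin (mE e) → ℝ
  f : (v : V) → EuclideanSpace ℝ (Fin (n v)) → EReal

namespace PDMMProblem

variable {V : Type*} [Fintype V] (P : PDMMProblem V)

/-- The primal space `∏_v ℝ^(n v)` with its Euclidean norm. -/
abbrev Primal : Type _ := PiLp 2 fun v : V => EuclideanSpace ℝ (Fin (P.n v))

/-- Index set of the `2m` scalar auxiliary variables: the triple (edge `e = {i, j}`, row `l` of `e`,
endpoint `i` of `e`) indexes the `l`-th entry of `z_{i|j}`. -/
abbrev Coord : Type _ :=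
  Σ e : P.G.edgeSet, (Fin (P.mI e.1) ⊕ Fin (P.mE e.1)) × {v : V // v ∈ e.1}

noncomputable instance : Fintype P.Coord := Fintype.ofFinite _

/-- The space `ℝ^(2m)` of auxiliary variables. -/
abbrev Aux : Type _ := EuclideanSpace ℝ P.Coord

variable {P} in
/-- For the coordinate of an entry of `z_{i|j}`, the node `i`. -/
def Coord.node (r : P.Coord) : V := r.2.2.1

variable {P} in
/-- For the coordinate of an entry of `z_{i|j}`, the neighbour `j`. -/
noncomputable def Coord.nbr (r : P.Coord) : V := Sym2.Mem.other r.2.2.2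

variable {P} in
/-- The permutation `P` exchanging the entries of `z_{i|j}` and `z_{j|i}`. -/
noncomputable def Coord.swap (r : P.Coord) : P.Coord :=
  ⟨r.1, r.2.1, Sym2.Mem.other r.2.2.2, Sym2.other_mem r.2.2.2⟩

/-- The separable cost `f(x) = ∑ f_i(x_i)`. -/
noncomputable def cost (x : P.Primal) : EReal := ∑ v, P.f v (x v)

/-- Feasibility for the constraints `A_{ij} x_i + A_{ji} x_j ≤ b_{ij}` (inequality rows) and
`A_{ij} x_i + A_{ji} x_j = b_{ij}` (equality rows). -/
def Feasible (x : P.Primal) : Prop :=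
  ∀ i j : V, P.G.Adj i j →
    (∀ l : Fin (P.mI s(i, j)),
      ((P.A s(i, j) i).mulVec (x i).ofLp + (P.A s(i, j) j).mulVec (x j).ofLp) (Sum.inl l)
        ≤ P.b s(i, j) (Sum.inl l)) ∧
    (∀ l : Fin (P.mE s(i, j)),
      ((P.A s(i, j) i).mulVec (x i).ofLp + (P.A s(i, j) j).mulVec (x j).ofLp) (Sum.inr l)
        = P.b s(i, j) (Sum.inr l))

/-- `x` is an optimal solution of the constrained problem. -/
def IsSolution (x : P.Primal) : Prop :=
  P.Feasible x ∧ ∀ x', P.Feasible x' → P.cost x ≤ P.cost x'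

/-- The `2m × n` matrix `C`: the block of `C x` belonging to `z_{i|j}` is `A_{ij} x_i`. -/
noncomputable def C : P.Primal →ₗ[ℝ] P.Aux where
  toFun x := WithLp.toLp 2 fun r =>
    (P.A r.1.1 r.2.2.1).mulVec (x r.2.2.1).ofLp r.2.1
  map_add' x y := by
    ext r
    simp [Matrix.mulVec_add]
  map_smul' a x := by
    ext r
    simp [Matrix.mulVec_smul]

/-- The vector `d = ½ (b, b)`. -/
noncomputable def d : P.Aux := WithLp.toLp 2 fun r => P.b r.1.1 r.2.1 / 2

/-- `M = {μ | μ = P μ, and μ ≥ 0 on the entries belonging to inequality constraints}`. -/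
def M : Set P.Aux :=
  {μ | (∀ r : P.Coord, μ r.swap = μ r) ∧ ∀ r : P.Coord, r.2.1.isLeft = true → 0 ≤ μ r}

/-- `T₁(μ) = -C ∂f*(-Cᵀ μ) + d`. -/
noncomputable def T₁ (μ : P.Aux) : Set P.Aux :=
  {w | ∃ x ∈ subdifferential (conjugate P.cost) (-(LinearMap.adjoint P.C μ)), w = -(P.C x) + P.d}

/-- `T₂ = N_M`. -/
def T₂ (μ : P.Aux) : Set P.Aux := normalCone P.M μ

/-- The (Peaceman-Rachford) IEQ-PDMM operator `C_{cT₂} ∘ C_{cT₁}`. -/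
noncomputable def op (c : ℝ) : P.Aux → P.Aux := cayley c P.T₂ ∘ cayley c P.T₁

/-- The relaxed IEQ-PDMM operator `(1 - α) I + α C_{cT₂} ∘ C_{cT₁}`; `α = 1` means no averaging. -/
noncomputable def avgOp (c α : ℝ) (z : P.Aux) : P.Aux := (1 - α) • z + α • P.op c z

/-- `x ∈ argmin_x (f(x) + zᵀ C x + (c/2) ‖C x - d‖²)`. -/
def IsXUpdate (c : ℝ) (z : P.Aux) (x : P.Primal) : Prop :=
  IsMinOn (fun x => P.cost x + ((⟪z, P.C x⟫ + c / 2 * ‖P.C x - P.d‖ ^ 2 : ℝ) : EReal)) Set.univ x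

/-- The total cost is finite, differentiable and `m`-strongly convex for some `m > 0`. -/
def IsDiffStronglyConvex : Prop :=
  ∃ g : P.Primal → ℝ, (∀ x, P.cost x = (g x : EReal)) ∧ Differentiable ℝ g ∧
    ∃ m : ℝ, 0 < m ∧ StrongConvexOn Set.univ m g

end PDMMProblem

/-! ### Stochastic updates -/

section Stochastic

variable {Ω : Type*} [MeasurableSpace Ω]

/-- `(X k)` is an i.i.d. random process. -/
structure IsIID {β : Type*} [MeasurableSpace β] (Pr : Measure Ω) (X : ℕ → Ω → β) : Prop where
  measurable : ∀ k, Measurable (X k)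
  indep : iIndepFun X Pr
  ident : ∀ k, IdentDistrib (X k) (X 1) Pr Pr

/-- `(U k)` is an i.i.d. process of `{0,1}`-valued masks in which every coordinate has positive
probability to be selected. The entries of one mask may be dependent. -/
structure IsMaskProcess {ι : Type*} (Pr : Measure Ω) (U : ℕ → Ω → ι → ℝ) : Prop where
  iid : IsIID Pr U
  zero_or_one : ∀ k ω r, U k ω r = 0 ∨ U k ω r = 1
  pos : ∀ r, 0 < Pr {ω | U 1 ω r = 1}

/-- The stochastic Banach-Picard iteration `Z⁽ᵏ⁺¹⁾ = (I - U⁽ᵏ⁺¹⁾) Z⁽ᵏ⁾ + U⁽ᵏ⁺¹⁾ T(Z⁽ᵏ⁾)`,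
with `U` acting as a diagonal matrix. -/
noncomputable def stochIter {ι : Type*} (T : EuclideanSpace ℝ ι → EuclideanSpace ℝ ι)
    (U : ℕ → Ω → ι → ℝ) (z₀ : EuclideanSpace ℝ ι) : ℕ → Ω → EuclideanSpace ℝ ι
  | 0, _ => z₀
  | k + 1, ω => WithLp.toLp 2 fun r =>
      (1 - U (k + 1) ω r) * stochIter T U z₀ k ω r
        + U (k + 1) ω r * T (stochIter T U z₀ k ω) r

variable {V : Type*} [Fintype V] (P : PDMMProblem V)

open Classical in
/-- Asynchronous updating with active nodes `ζ k`: `U_{j|i} = 1` iff `i ∈ ζ`. -/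
noncomputable def asyncMask (ζ : ℕ → Ω → Set V) (k : ℕ) (ω : Ω) (r : P.Coord) : ℝ :=
  if r.nbr ∈ ζ k ω then 1 else 0

open Classical in
/-- Transmission losses with active directed edges `η k`: `U_{j|i} = 1` iff `(i, j) ∈ η`. -/
noncomputable def lossMask (η : ℕ → Ω → Set (V × V)) (k : ℕ) (ω : Ω) (r : P.Coord) : ℝ :=
  if (r.nbr, r.node) ∈ η k ω then 1 else 0

open Classical in
/-- Both combined: `U_{j|i} = 1` iff `i ∈ ζ` and `(i, j) ∈ η`. -/
noncomputable def lossyAsyncMask (ζ : ℕ → Ω → Set V) (η : ℕ → Ω → Set (V × V)) (k : ℕ) (ω : Ω)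
    (r : P.Coord) : ℝ :=
  if r.nbr ∈ ζ k ω ∧ (r.nbr, r.node) ∈ η k ω then 1 else 0

end Stochastic

/-! Fix a fixed point `y` of a quasi-nonexpansive `T` and put `p r = E[U 1 r] > 0`. A random mask
need not decrease `‖Z - y‖`, but the weighted sum `L k = ∑ r, (p r)⁻¹ * E[(Z k r - y r)²]` does
decrease: `U (k+1)` is independent of `Z k`, so the weights cancel the selection probabilities and
`L k - L (k+1)` is the expectation of the full-step gap `‖Z k - y‖² - ‖T (Z k) - y‖² ≥ 0`.
Telescoping bounds the sum of these expectations by `L 0`, so the gaps are almost surely summable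
and tend to 0 (`ae_tendsto_norm_sq_sub_norm_sq_stochIter`). No martingale theorem is involved.

It remains to see what the gap controls. For an averaged operator it dominates a multiple of `‖z - T
z‖²`. The PDMM operator is a composition of two Cayley operators of monotone operators, hence
nonexpansive: projection onto `M` supplies the resolvent of `T₂`, and the `x`-update supplies that
of `T₁`. For a strongly convex cost the `T₁` reflection alone loses a multiple of `‖x - x*‖²`, which
survives without averaging. The fixed point needed in that case is built from a Karush-Kuhn-Tucker
multiplier; the constraints are affine, so Farkas' lemma provides it from feasibility alone. -/

/-! ### Farkas' lemma and multipliers over polyhedra -/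

/-- **Farkas' lemma** for finitely many linear functionals. -/
theorem exists_nonneg_combination_of_forall_nonpos {ι E : Type*} [AddCommGroup E] [Module ℝ E]
    (s : Finset ι) (a : ι → E →ₗ[ℝ] ℝ) (b : E →ₗ[ℝ] ℝ)
    (h : ∀ x, (∀ i ∈ s, a i x ≤ 0) → b x ≤ 0) :
    ∃ w : ι → ℝ, (∀ i, 0 ≤ w i) ∧ ∀ x, b x = ∑ i ∈ s, w i * a i x := by
  classical
  induction s using Finset.induction_on generalizing a b with
  | empty =>
    refine ⟨0, fun i => le_rfl, fun x => ?_⟩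
    have h1 := h x (by simp)
    have h2 := h (-x) (by simp)
    rw [map_neg] at h2
    simp only [Finset.sum_empty]
    linarith
  | insert j s hj ih =>
    by_cases hb : ∀ x, (∀ i ∈ s, a i x ≤ 0) → b x ≤ 0
    · obtain ⟨w, hw, hwb⟩ := ih a b hb
      refine ⟨fun i => if i = j then 0 else w i, fun i => ?_, fun x => ?_⟩
      · dsimp only
        split_ifs
        exacts [le_rfl, hw i]
      · rw [Finset.sum_insert hj, hwb x]
        dsimp only
        rw [if_pos rfl, zero_mul, zero_add]
        refine Finset.sum_congr rfl fun i hi => ?_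
        rw [if_neg (ne_of_mem_of_not_mem hi hj)]
    · push Not at hb
      obtain ⟨y, hya, hyb⟩ := hb
      have hyj : 0 < a j y := by
        by_contra hcon
        refine absurd (h y fun i hi => ?_) (not_le.2 hyb)
        rcases Finset.mem_insert.1 hi with rfl | hi
        exacts [not_lt.1 hcon, hya i hi]
      -- Subtracting multiples of `a j` makes every functional vanish at `y`. The hypothesis is then
      -- tested at the projection of `x` along `y` onto the kernel of `a j`, where constraint `j`
      -- holds with equality.
      obtain ⟨w, hw, hwb⟩ := ih (fun i => a i - (a i y / a j y) • a j)
        (b - (b y / a j y) • a j) fun x hx => by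
          have key := h (x - (a j x / a j y) • y) fun i hi => by
            rcases Finset.mem_insert.1 hi with rfl | hi
            · simp [hyj.ne']
            · have := hx i hi
              simp only [LinearMap.sub_apply, LinearMap.smul_apply, smul_eq_mul, map_sub,
                map_smul] at this ⊢
              convert this using 1
              ring
          simp only [LinearMap.sub_apply, LinearMap.smul_apply, smul_eq_mul, map_sub,
            map_smul] at key ⊢
          convert key using 1
          ring
      -- The coefficient of `a j` is forced by the identity at `y`; it is nonnegative because `b y >
      -- 0` while `a i y ≤ 0` on `s`.
      refine ⟨fun i => if i = j then (b y - ∑ i ∈ s, w i * a i y) / a j y else w i,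
        fun i => ?_, fun x => ?_⟩
      · dsimp only
        split_ifs
        · refine div_nonneg ?_ hyj.le
          have : ∑ i ∈ s, w i * a i y ≤ 0 :=
            Finset.sum_nonpos fun i hi => mul_nonpos_of_nonneg_of_nonpos (hw i) (hya i hi)
          linarith
        · exact hw i
      · have hx := hwb x
        simp only [LinearMap.sub_apply, LinearMap.smul_apply, smul_eq_mul] at hx
        rw [Finset.sum_insert hj]
        dsimp only
        rw [if_pos rfl]
        have h1 : ∑ i ∈ s, (if i = j then (b y - ∑ i ∈ s, w i * a i y) / a j y else w i) * a i x
            = ∑ i ∈ s, w i * a i x := Finset.sum_congr rfl fun i hi => by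
          rw [if_neg (ne_of_mem_of_not_mem hi hj)]
        have h2 : ∑ i ∈ s, w i * (a i x - a i y / a j y * a j x)
            = ∑ i ∈ s, w i * a i x - (∑ i ∈ s, w i * a i y) / a j y * a j x := by
          rw [Finset.sum_div, Finset.sum_mul, ← Finset.sum_sub_distrib]
          exact Finset.sum_congr rfl fun i _ => by ring
        rw [h1]
        rw [h2] at hx
        linear_combination hx

/-- The **Karush-Kuhn-Tucker conditions** at a minimiser over a polyhedron. -/
theorem exists_multipliers_of_isMinOn_polyhedron {ι E : Type*} [Fintype ι] [NormedAddCommGroup E]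
    [NormedSpace ℝ E] (a : ι → E →ₗ[ℝ] ℝ) (β : ι → ℝ) {g : E → ℝ} {g' : E →L[ℝ] ℝ} {x : E}
    (hg : HasFDerivAt g g' x) (hx : ∀ i, a i x ≤ β i)
    (hmin : ∀ y, (∀ i, a i y ≤ β i) → g x ≤ g y) :
    ∃ w : ι → ℝ, (∀ i, 0 ≤ w i) ∧ (∀ h, -g' h = ∑ i, w i * a i h) ∧
      ∀ i, w i * (a i x - β i) = 0 := by
  classical
  obtain ⟨w, hw, hwg⟩ := exists_nonneg_combination_of_forall_nonpos
    (Finset.univ.filter fun i => a i x = β i) a (-g').toLinearMap fun h hh => by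
      -- Only active constraints restrict the direction `h`: the others are strict at `x` and
      -- persist for small `t`.
      have hfeas : ∀ᶠ t : ℝ in 𝓝[>] 0, ∀ i, a i (x + t • h) ≤ β i := by
        refine eventually_all.2 fun i => ?_
        by_cases hi : a i x = β i
        · filter_upwards [self_mem_nhdsWithin] with t ht
          have := mul_nonpos_of_nonneg_of_nonpos (le_of_lt ht) (hh i (by simp [hi]))
          simp only [map_add, map_smul, smul_eq_mul]
          linarith
        · have hc : Tendsto (fun t : ℝ => a i x + t * a i h) (𝓝[>] 0) (𝓝 (a i x + 0 * a i h)) :=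
            ((continuous_const.add (continuous_id.mul continuous_const)).tendsto 0).mono_left
              nhdsWithin_le_nhds
          have hlt : a i x + 0 * a i h < β i := by simpa using lt_of_le_of_ne (hx i) hi
          filter_upwards [hc.eventually_lt_const hlt] with t ht
          simpa using ht.le
      have hd : HasDerivAt _ _ _ := hg.hasLineDerivAt h
      have hs := hd.tendsto_slope_zero_right
      have : 0 ≤ g' h := by
        refine ge_of_tendsto hs ?_
        filter_upwards [hfeas, self_mem_nhdsWithin] with t ht ht0
        have := hmin _ ht
        simp only [zero_add, zero_smul, add_zero, smul_eq_mul]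
        exact mul_nonneg (inv_nonneg.2 (le_of_lt ht0)) (by linarith)
      simpa using this
  refine ⟨fun i => if a i x = β i then w i else 0, fun i => ?_, fun h => ?_, fun i => ?_⟩
  · dsimp only
    split_ifs
    exacts [hw i, le_rfl]
  · have := hwg h
    rw [Finset.sum_filter] at this
    simp only [ite_mul, zero_mul]
    simpa using this
  · dsimp only
    split_ifs with hi
    · simp [hi]
    · simp

/-! ### Stochastic iteration: almost sure vanishing of the full-step gap -/

/-- By Tonelli the series of the `f k` has finite expectation, so it converges almost surely and its
terms vanish. -/
theorem ae_tendsto_zero_of_sum_integral_le {Ω : Type*} [MeasurableSpace Ω] {μ : Measure Ω}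
    {f : ℕ → Ω → ℝ} (hf : ∀ k, Integrable (f k) μ) (h0 : ∀ k ω, 0 ≤ f k ω) {B : ℝ}
    (hB : ∀ n, ∑ k ∈ Finset.range n, ∫ ω, f k ω ∂μ ≤ B) :
    ∀ᵐ ω ∂μ, Tendsto (fun k => f k ω) atTop (𝓝 0) := by
  have hm : ∀ k, AEMeasurable (fun ω => ENNReal.ofReal (f k ω)) μ :=
    fun k => (hf k).aestronglyMeasurable.aemeasurable.ennreal_ofReal
  have hfin : ∫⁻ ω, ∑' k, ENNReal.ofReal (f k ω) ∂μ ≠ ⊤ := by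
    rw [lintegral_tsum hm]
    refine ne_top_of_le_ne_top (ENNReal.ofReal_ne_top (r := B)) ?_
    rw [ENNReal.tsum_eq_iSup_nat]
    refine iSup_le fun n => ?_
    calc ∑ k ∈ Finset.range n, ∫⁻ ω, ENNReal.ofReal (f k ω) ∂μ
        = ∑ k ∈ Finset.range n, ENNReal.ofReal (∫ ω, f k ω ∂μ) :=
          Finset.sum_congr rfl fun k _ =>
            (ofReal_integral_eq_lintegral_ofReal (hf k) (ae_of_all _ (h0 k))).symm
      _ = ENNReal.ofReal (∑ k ∈ Finset.range n, ∫ ω, f k ω ∂μ) :=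
          (ENNReal.ofReal_sum_of_nonneg fun k _ => integral_nonneg (h0 k)).symm
      _ ≤ ENNReal.ofReal B := ENNReal.ofReal_le_ofReal (hB n)
  filter_upwards [ae_lt_top' (AEMeasurable.tsum hm) hfin] with ω hω
  have h := ENNReal.tendsto_atTop_zero_of_tsum_ne_top hω.ne
  have h' := (ENNReal.tendsto_toReal ENNReal.zero_ne_top).comp h
  simpa [Function.comp_def, ENNReal.toReal_ofReal (h0 _ ω)] using h'

theorem stochIter_succ_apply {Ω ι : Type*} (T : EuclideanSpace ℝ ι → EuclideanSpace ℝ ι) (U : ℕ → Ω → ι → ℝ)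
    (z₀ : EuclideanSpace ℝ ι) (k : ℕ) (ω : Ω) (r : ι) :
    stochIter T U z₀ (k + 1) ω r = (1 - U (k + 1) ω r) * stochIter T U z₀ k ω r
        + U (k + 1) ω r * T (stochIter T U z₀ k ω) r := rfl

theorem IsMaskProcess.integral_pos {Ω ι : Type*} [MeasurableSpace Ω] {Pr : Measure Ω}
    [IsProbabilityMeasure Pr] {U : ℕ → Ω → ι → ℝ} (hU : IsMaskProcess Pr U) (r : ι) :
    0 < ∫ ω, U 1 ω r ∂Pr := by
  have hm : Measurable fun ω => U 1 ω r := (measurable_pi_apply r).comp (hU.iid.measurable 1)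
  have hs : MeasurableSet {ω | U 1 ω r = 1} := hm (measurableSet_singleton 1)
  have : (fun ω => U 1 ω r) = {ω | U 1 ω r = 1}.indicator 1 := by
    ext ω
    rcases hU.zero_or_one 1 ω r with h | h <;> simp [Set.indicator, h]
  rw [this, integral_indicator_one hs]
  exact ENNReal.toReal_pos (hU.pos r).ne' (measure_ne_top _ _)

/-- Since `U` takes only the values 0 and 1, the new squared error is affine in `U`; after
independence only the mean of `U` matters. -/
theorem sq_stochIter_succ_sub {Ω ι : Type*} [MeasurableSpace Ω] {Pr : Measure Ω}
    {U : ℕ → Ω → ι → ℝ} {T : EuclideanSpace ℝ ι → EuclideanSpace ℝ ι} (hU : IsMaskProcess Pr U) (z₀ y : EuclideanSpace ℝ ι) (k : ℕ)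
    (ω : Ω) (r : ι) :
    (stochIter T U z₀ (k + 1) ω r - y r) ^ 2 = (stochIter T U z₀ k ω r - y r) ^ 2 +
      U (k + 1) ω r * ((T (stochIter T U z₀ k ω) r - y r) ^ 2
        - (stochIter T U z₀ k ω r - y r) ^ 2) := by
  rw [stochIter_succ_apply]
  rcases hU.zero_or_one (k + 1) ω r with h | h <;> rw [h] <;> ring

section StochasticIteration

variable {Ω : Type*} [MeasurableSpace Ω] {Pr : Measure Ω} {ι : Type*} [Fintype ι]
  {U : ℕ → Ω → ι → ℝ} {T : EuclideanSpace ℝ ι → EuclideanSpace ℝ ι}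

/-- Adaptedness to the masks up to time `k`, which is what makes `U (k + 1)` independent of the
current iterate. -/
theorem measurable_stochIter_natural (hU : ∀ k, StronglyMeasurable (U k)) (hT : Measurable T)
    (z₀ : EuclideanSpace ℝ ι) (k : ℕ) :
    Measurable[Filtration.natural U hU k] (stochIter T U z₀ k) := by
  induction k with
  | zero => exact measurable_const
  | succ k ih =>
    have h1 : Measurable[Filtration.natural U hU (k + 1)] (stochIter T U z₀ k) :=
      ih.mono ((Filtration.natural U hU).mono (Nat.le_succ k)) le_rfl
    have h2 : Measurable[Filtration.natural U hU (k + 1)] (U (k + 1)) :=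
      measurable_iff_comap_le.2
        (le_iSup₂_of_le (f := fun j (_ : j ≤ k + 1) => MeasurableSpace.comap (U j) _)
          (k + 1) le_rfl le_rfl)
    refine (WithLp.measurable_toLp 2 _).comp
      (@measurable_pi_lambda _ _ _ (Filtration.natural U hU (k + 1)) _ _ fun r => ?_)
    have hr : ∀ {g : Ω → EuclideanSpace ℝ ι}, Measurable[Filtration.natural U hU (k + 1)] g →
        Measurable[Filtration.natural U hU (k + 1)] fun ω => g ω r := fun hg =>
      (EuclideanSpace.proj (𝕜 := ℝ) r).continuous.measurable.comp hg
    have h3 : Measurable[Filtration.natural U hU (k + 1)] fun ω => U (k + 1) ω r :=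
      (measurable_pi_apply r).comp h2
    exact ((measurable_const.sub h3).mul (hr h1)).add (h3.mul (hr (hT.comp h1)))

theorem norm_sq_sub_eq_sum (x y : EuclideanSpace ℝ ι) : ‖x - y‖ ^ 2 = ∑ r, (x r - y r) ^ 2 := by
  simp [EuclideanSpace.real_norm_sq_eq]

theorem sq_apply_sub_le (x y : EuclideanSpace ℝ ι) (r : ι) : (x r - y r) ^ 2 ≤ ‖x - y‖ ^ 2 := by
  rw [norm_sq_sub_eq_sum]
  exact Finset.single_le_sum (f := fun r => (x r - y r) ^ 2) (fun _ _ => sq_nonneg _)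
    (Finset.mem_univ r)

/-- A crude deterministic bound, needed only for integrability: each coordinate is either kept or
replaced, so its square is at most the sum of both. -/
theorem norm_sq_stochIter_sub_le (hU : IsMaskProcess Pr U) {y : EuclideanSpace ℝ ι}
    (hTy : ∀ z, ‖T z - y‖ ≤ ‖z - y‖) (z₀ : EuclideanSpace ℝ ι) (k : ℕ) (ω : Ω) :
    ‖stochIter T U z₀ k ω - y‖ ^ 2 ≤ 2 ^ k * ‖z₀ - y‖ ^ 2 := by
  induction k with
  | zero => simp [stochIter]
  | succ k ih =>
    have h1 : ‖stochIter T U z₀ (k + 1) ω - y‖ ^ 2 ≤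
        ‖stochIter T U z₀ k ω - y‖ ^ 2 + ‖T (stochIter T U z₀ k ω) - y‖ ^ 2 := by
      simp only [norm_sq_sub_eq_sum, ← Finset.sum_add_distrib]
      refine Finset.sum_le_sum fun r _ => ?_
      rw [sq_stochIter_succ_sub hU]
      rcases hU.zero_or_one (k + 1) ω r with h | h <;> rw [h]
      · nlinarith [sq_nonneg (T (stochIter T U z₀ k ω) r - y r)]
      · nlinarith [sq_nonneg (stochIter T U z₀ k ω r - y r)]
    have h2 := pow_le_pow_left₀ (norm_nonneg _) (hTy (stochIter T U z₀ k ω)) 2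
    have h3 : (2 : ℝ) ^ (k + 1) = 2 ^ k * 2 := pow_succ 2 k
    rw [h3]
    linarith

theorem IsMaskProcess.integral_mul_eq [IsProbabilityMeasure Pr] (hU : IsMaskProcess Pr U)
    (hT : Measurable T) (z₀ : EuclideanSpace ℝ ι) (k : ℕ) (r : ι) {g : EuclideanSpace ℝ ι → ℝ}
    (hg : Measurable g) :
    ∫ ω, U (k + 1) ω r * g (stochIter T U z₀ k ω) ∂Pr =
      (∫ ω, U 1 ω r ∂Pr) * ∫ ω, g (stochIter T U z₀ k ω) ∂Pr := by
  have hUs : ∀ k, StronglyMeasurable (U k) := fun k => (hU.iid.measurable k).stronglyMeasurable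
  have hZ := measurable_stochIter_natural hUs hT z₀ k
  have hindep : IndepFun (U (k + 1)) (stochIter T U z₀ k) Pr :=
    (IndepFun_iff_Indep _ _ _).2 (indep_of_indep_of_le_right
      (hU.iid.indep.indep_comap_natural_of_lt hUs (Nat.lt_succ_self k)) hZ.comap_le)
  have hid : ∫ ω, U (k + 1) ω r ∂Pr = ∫ ω, U 1 ω r ∂Pr :=
    ((hU.iid.ident (k + 1)).comp (measurable_pi_apply r)).integral_eq
  rw [← hid]
  exact (hindep.comp (measurable_pi_apply r) hg).integral_fun_mul_eq_mul_integral
    ((measurable_pi_apply r).comp (hU.iid.measurable _)).aestronglyMeasurable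
    (hg.comp (hZ.mono ((Filtration.natural U hUs).le k) le_rfl)).aestronglyMeasurable

/-- Along the stochastic iteration of a quasi-nonexpansive operator `T`, the decrease of the squared
distance to a fixed point `y` that a full step would achieve vanishes almost surely. -/
theorem ae_tendsto_norm_sq_sub_norm_sq_stochIter [IsProbabilityMeasure Pr]
    (hU : IsMaskProcess Pr U) (hT : Measurable T) {y : EuclideanSpace ℝ ι}
    (hTy : ∀ z, ‖T z - y‖ ≤ ‖z - y‖) (z₀ : EuclideanSpace ℝ ι) :
    ∀ᵐ ω ∂Pr, Tendsto (fun k => ‖stochIter T U z₀ k ω - y‖ ^ 2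
      - ‖T (stochIter T U z₀ k ω) - y‖ ^ 2) atTop (𝓝 0) := by
  set Z := stochIter T U z₀ with hZdef
  have hsq : ∀ z, ‖T z - y‖ ^ 2 ≤ ‖z - y‖ ^ 2 :=
    fun z => pow_le_pow_left₀ (norm_nonneg _) (hTy z) 2
  have hZ : ∀ k, Measurable (Z k) := fun k =>
    (measurable_stochIter_natural (fun k => (hU.iid.measurable k).stronglyMeasurable) hT z₀ k).mono
      (Filtration.le _ k) le_rfl
  have hproj : ∀ r : ι, Measurable fun z : EuclideanSpace ℝ ι => z r := fun r =>
    (EuclideanSpace.proj (𝕜 := ℝ) r).continuous.measurable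
  have hm1 : ∀ r, Measurable fun z : EuclideanSpace ℝ ι => (z r - y r) ^ 2 :=
    fun r => ((hproj r).sub_const _).pow_const 2
  have hm2 : ∀ r, Measurable fun z : EuclideanSpace ℝ ι => (T z r - y r) ^ 2 :=
    fun r => (hm1 r).comp hT
  have hbound : ∀ k ω, ‖Z k ω - y‖ ^ 2 ≤ 2 ^ k * ‖z₀ - y‖ ^ 2 :=
    norm_sq_stochIter_sub_le hU hTy z₀
  have hi1 : ∀ k r, Integrable (fun ω => (Z k ω r - y r) ^ 2) Pr := fun k r =>
    Integrable.of_bound ((hm1 r).comp (hZ k)).aestronglyMeasurable (2 ^ k * ‖z₀ - y‖ ^ 2)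
      (ae_of_all _ fun ω => by
        rw [Real.norm_of_nonneg (sq_nonneg _)]
        exact (sq_apply_sub_le _ _ _).trans (hbound k ω))
  have hi2 : ∀ k r, Integrable (fun ω => (T (Z k ω) r - y r) ^ 2) Pr := fun k r =>
    Integrable.of_bound ((hm2 r).comp (hZ k)).aestronglyMeasurable (2 ^ k * ‖z₀ - y‖ ^ 2)
      (ae_of_all _ fun ω => by
        rw [Real.norm_of_nonneg (sq_nonneg _)]
        exact ((sq_apply_sub_le _ _ _).trans (hsq _)).trans (hbound k ω))
  have hstep : ∀ k r, ∫ ω, (Z (k + 1) ω r - y r) ^ 2 ∂Pr = ∫ ω, (Z k ω r - y r) ^ 2 ∂Pr +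
      (∫ ω, U 1 ω r ∂Pr) * ∫ ω, ((T (Z k ω) r - y r) ^ 2 - (Z k ω r - y r) ^ 2) ∂Pr := by
    intro k r
    have hUm : Measurable fun ω => U (k + 1) ω r :=
      (measurable_pi_apply r).comp (hU.iid.measurable _)
    have hint : Integrable (fun ω => U (k + 1) ω r *
        ((T (Z k ω) r - y r) ^ 2 - (Z k ω r - y r) ^ 2)) Pr :=
      ((hi2 k r).sub (hi1 k r)).bdd_mul hUm.aestronglyMeasurable (c := 1)
        (ae_of_all _ fun ω => by rcases hU.zero_or_one (k + 1) ω r with h | h <;> simp [h])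
    simp only [hZdef, sq_stochIter_succ_sub hU]
    rw [integral_add (hi1 k r) hint]
    exact congrArg _ (hU.integral_mul_eq hT z₀ k r ((hm2 r).sub (hm1 r)))
  have hpos := hU.integral_pos
  -- The inverse selection probabilities as weights turn the expected masked decrease into the
  -- unmasked one.
  set L : ℕ → ℝ := fun k => ∑ r, (∫ ω, U 1 ω r ∂Pr)⁻¹ * ∫ ω, (Z k ω r - y r) ^ 2 ∂Pr with hL
  have hfint : ∀ k, Integrable (fun ω => ‖Z k ω - y‖ ^ 2 - ‖T (Z k ω) - y‖ ^ 2) Pr := fun k => by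
    simp only [norm_sq_sub_eq_sum, ← Finset.sum_sub_distrib]
    exact integrable_finsetSum _ fun r _ => (hi1 k r).sub (hi2 k r)
  have hLstep : ∀ k, ∫ ω, (‖Z k ω - y‖ ^ 2 - ‖T (Z k ω) - y‖ ^ 2) ∂Pr = L k - L (k + 1) := by
    intro k
    simp only [norm_sq_sub_eq_sum, ← Finset.sum_sub_distrib, hL]
    refine (integral_finsetSum _ fun r _ => (hi1 k r).sub (hi2 k r)).trans
      (Finset.sum_congr rfl fun r _ => ?_)
    simp only [Pi.sub_apply]
    rw [hstep, integral_sub (hi1 k r) (hi2 k r), integral_sub (hi2 k r) (hi1 k r)]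
    field_simp [(hpos r).ne']
    ring
  refine ae_tendsto_zero_of_sum_integral_le hfint (fun k ω => sub_nonneg.2 (hsq _)) (B := L 0)
    fun n => ?_
  rw [Finset.sum_congr rfl fun k _ => hLstep k, Finset.sum_range_sub']
  have : 0 ≤ L n := Finset.sum_nonneg fun r _ =>
    mul_nonneg (inv_nonneg.2 (hpos r).le) (integral_nonneg fun ω => sq_nonneg _)
  linarith

end StochasticIteration

/-! ### Monotone operators, conjugates and averaged maps -/

section MonotoneOperators

variable {E : Type*} [NormedAddCommGroup E] [InnerProductSpace ℝ E]

/-- A set-valued operator is monotone. -/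
def IsMonotoneOp (A : E → Set E) : Prop :=
  ∀ p p', ∀ u ∈ A p, ∀ u' ∈ A p', 0 ≤ ⟪u - u', p - p'⟫

/-- Kept as an identity rather than an inequality: the inner product term is later the source of
primal convergence. -/
theorem norm_sq_reflected_sub (c : ℝ) (p p' u u' : E) :
    ‖(p - c • u) - (p' - c • u')‖ ^ 2 =
      ‖(p + c • u) - (p' + c • u')‖ ^ 2 - 4 * c * ⟪u - u', p - p'⟫ := by
  have h1 : (p - c • u) - (p' - c • u') = (p - p') - c • (u - u') := by module
  have h2 : (p + c • u) - (p' + c • u') = (p - p') + c • (u - u') := by module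
  rw [h1, h2, norm_sub_sq_real, norm_add_sq_real, real_inner_smul_right, real_inner_comm (u - u')]
  ring

/-- The resolvent is a choice, so its value is known only through uniqueness: two decompositions of
one point give `q - p = -(c • (v - u))`, and monotonicity then forces `v = u`. -/
theorem IsMonotoneOp.monResolvent_eq {A : E → Set E} (hA : IsMonotoneOp A) {c : ℝ} (hc : 0 < c)
    {p u : E} (hu : u ∈ A p) : monResolvent c A (p + c • u) = p := by
  have hex : ∃ q, ∃ v ∈ A q, p + c • u = q + c • v := ⟨p, u, hu, rfl⟩
  obtain ⟨v, hv, hpv⟩ := Classical.epsilon_spec hex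
  change v ∈ A (monResolvent c A (p + c • u)) at hv
  change _ = monResolvent c A (p + c • u) + _ at hpv
  set q := monResolvent c A (p + c • u)
  have h := hA q p v hv u hu
  have hqp : q - p = -(c • (v - u)) := by
    rw [smul_sub, sub_eq_iff_eq_add]
    linear_combination (norm := module) -hpv
  rw [hqp, inner_neg_right, real_inner_smul_right, real_inner_self_eq_norm_sq] at h
  have h0 : v - u = 0 := by
    rw [← norm_eq_zero, ← sq_eq_zero_iff]
    nlinarith [sq_nonneg ‖v - u‖]
  rw [h0, smul_zero, neg_zero] at hqp
  exact sub_eq_zero.1 hqp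

theorem IsMonotoneOp.cayley_eq {A : E → Set E} (hA : IsMonotoneOp A) {c : ℝ} (hc : 0 < c)
    {p u : E} (hu : u ∈ A p) : cayley c A (p + c • u) = p - c • u := by
  rw [cayley, hA.monResolvent_eq hc hu]
  module

theorem IsMonotoneOp.lipschitzWith_cayley {A : E → Set E} (hA : IsMonotoneOp A) {c : ℝ}
    (hc : 0 < c) (hex : ∀ z, ∃ p, ∃ u ∈ A p, z = p + c • u) : LipschitzWith 1 (cayley c A) := by
  refine LipschitzWith.of_dist_le_mul fun z z' => ?_
  obtain ⟨p, u, hu, rfl⟩ := hex z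
  obtain ⟨p', u', hu', rfl⟩ := hex z'
  rw [hA.cayley_eq hc hu, hA.cayley_eq hc hu', dist_eq_norm, dist_eq_norm, NNReal.coe_one, one_mul]
  refine le_of_sq_le_sq ?_ (norm_nonneg _)
  rw [norm_sq_reflected_sub]
  nlinarith [mul_nonneg hc.le (hA _ _ _ hu _ hu')]

theorem isMonotoneOp_normalCone (M : Set E) : IsMonotoneOp (normalCone M) := by
  intro p p' u hu u' hu'
  have h1 := hu.2 p' hu'.1
  have h2 := hu'.2 p hu.1
  have h3 : ⟪u - u', p - p'⟫ = -⟪u, p' - p⟫ - ⟪u', p - p'⟫ := by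
    rw [inner_sub_left, ← inner_neg_right, neg_sub]
  linarith

/-- The point `p` is the projection of `z` onto `M`, whose variational inequality says that `z - p`
is normal. -/
theorem exists_mem_normalCone_add_smul [CompleteSpace E] {M : Set E} (hne : M.Nonempty)
    (hcl : IsClosed M) (hconv : Convex ℝ M) {c : ℝ} (hc : 0 < c) (z : E) :
    ∃ p, ∃ u ∈ normalCone M p, z = p + c • u := by
  obtain ⟨p, hp, hpn⟩ := exists_norm_eq_iInf_of_complete_convex hne hcl.isComplete hconv z
  rw [norm_eq_iInf_iff_real_inner_le_zero hconv hp] at hpn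
  refine ⟨p, c⁻¹ • (z - p), ⟨hp, fun w hw => ?_⟩, ?_⟩
  · rw [real_inner_smul_left]
    exact mul_nonpos_of_nonneg_of_nonpos (inv_nonneg.2 hc.le) (hpn w hw)
  · rw [smul_smul, mul_inv_cancel₀ hc.ne', one_smul]
    abel

/-- Add the two subgradient inequalities. A point with finite value is required because where `g` is
identically `⊤` every vector is a subgradient. -/
theorem inner_sub_sub_nonneg_of_mem_subdifferential {g : E → EReal} (hbot : ∀ y, g y ≠ ⊥)
    (hfin : ∃ y, g y ≠ ⊤) {y y' u u' : E} (hu : u ∈ subdifferential g y)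
    (hu' : u' ∈ subdifferential g y') : 0 ≤ ⟪u - u', y - y'⟫ := by
  have hfinite : ∀ {y u : E}, u ∈ subdifferential g y → ∃ a : ℝ, g y = a := by
    intro y u hu
    refine ⟨(g y).toReal, (EReal.coe_toReal (fun htop => ?_) (hbot y)).symm⟩
    obtain ⟨w, hw⟩ := hfin
    have := hu w
    rw [htop, EReal.top_add_coe, top_le_iff] at this
    exact hw this
  obtain ⟨a, ha⟩ := hfinite hu
  obtain ⟨a', ha'⟩ := hfinite hu'
  have h1 := hu y'
  have h2 := hu' y
  rw [ha, ha', ← EReal.coe_add, EReal.coe_le_coe_iff] at h1 h2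
  have h3 : ⟪u - u', y - y'⟫ = -⟪u, y' - y⟫ - ⟪u', y - y'⟫ := by
    rw [inner_sub_left, ← inner_neg_right, neg_sub]
  linarith

theorem le_conjugate {F : E → EReal} {x : E} {a : ℝ} (hx : F x = a) (y : E) :
    ((⟪y, x⟫ - a : ℝ) : EReal) ≤ conjugate F y := by
  rw [EReal.coe_sub, ← hx]
  exact le_iSup (fun x : E => ((⟪y, x⟫ : ℝ) : EReal) - F x) x

theorem conjugate_eq_of_mem_subdifferential {F : E → EReal} {x v : E} {a : ℝ} (hx : F x = a)
    (hv : v ∈ subdifferential F x) : conjugate F v = ((⟪v, x⟫ - a : ℝ) : EReal) := by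
  refine le_antisymm (iSup_le fun y => ?_) (le_conjugate hx v)
  have h := hv y
  rw [hx, ← EReal.coe_add] at h
  refine (EReal.sub_le_sub le_rfl h).trans ?_
  rw [← EReal.coe_sub, EReal.coe_le_coe_iff, inner_sub_right]
  linarith

/-- Equality in Fenchel-Young at `(x, v)`, compared with the inequality at `(x, y)`. This direction
of subgradient inversion needs neither closedness nor convexity of `F`. -/
theorem mem_subdifferential_conjugate {F : E → EReal} {x v : E} {a : ℝ} (hx : F x = a)
    (hv : v ∈ subdifferential F x) : x ∈ subdifferential (conjugate F) v := by
  intro y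
  rw [conjugate_eq_of_mem_subdifferential hx hv, ← EReal.coe_add]
  refine le_trans (le_of_eq ?_) (le_conjugate hx y)
  rw [inner_sub_right, real_inner_comm, real_inner_comm y]
  congr 1
  ring

theorem IsAveraged.lipschitzWith {α : ℝ} {T : E → E} (hT : IsAveraged α T) : LipschitzWith 1 T := by
  obtain ⟨h0, h1, R, hR, hTR⟩ := hT
  refine LipschitzWith.of_dist_le_mul fun z z' => ?_
  have h := hR.dist_le_mul z z'
  rw [NNReal.coe_one, one_mul, dist_eq_norm, dist_eq_norm] at h ⊢
  have : T z - T z' = (1 - α) • (z - z') + α • (R z - R z') := by rw [hTR, hTR]; module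
  rw [this]
  refine (norm_add_le _ _).trans ?_
  rw [norm_smul, norm_smul, Real.norm_of_nonneg h0.le, Real.norm_of_nonneg (sub_nonneg.2 h1.le)]
  nlinarith

theorem norm_sq_convex_comb (α : ℝ) (u v : E) :
    ‖(1 - α) • u + α • v‖ ^ 2 =
      (1 - α) * ‖u‖ ^ 2 + α * ‖v‖ ^ 2 - α * (1 - α) * ‖u - v‖ ^ 2 := by
  rw [norm_add_sq_real, norm_sub_sq_real, norm_smul, norm_smul, real_inner_smul_left,
    real_inner_smul_right, mul_pow, mul_pow, Real.norm_eq_abs, Real.norm_eq_abs, sq_abs, sq_abs]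
  ring

/-- `R` shares the fixed point `y`, and the identity for `‖(1 - α) • u + α • v‖²` with `u = z - y`,
`v = R z - y` contains the residual as its cross term. -/
theorem IsAveraged.norm_sq_residual_le {α : ℝ} {T : E → E} (hT : IsAveraged α T) {y : E}
    (hy : T y = y) (z : E) :
    (1 - α) * ‖z - T z‖ ^ 2 ≤ α * (‖z - y‖ ^ 2 - ‖T z - y‖ ^ 2) := by
  obtain ⟨h0, h1, R, hR, hTR⟩ := hT
  have hRy : R y = y := by
    have h : α • (R y - y) = 0 := by
      linear_combination (norm := module) (hTR y).symm.trans hy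
    exact sub_eq_zero.1 ((smul_eq_zero.1 h).resolve_left h0.ne')
  have hle : ‖R z - y‖ ≤ ‖z - y‖ := by
    have h := hR.dist_le_mul z y
    rwa [NNReal.coe_one, one_mul, dist_eq_norm, dist_eq_norm, hRy] at h
  have hsq := pow_le_pow_left₀ (norm_nonneg _) hle 2
  have e1 : T z - y = (1 - α) • (z - y) + α • (R z - y) := by rw [hTR]; module
  have e2 : z - T z = α • (z - R z) := by rw [hTR]; module
  have e3 : z - y - (R z - y) = z - R z := by abel
  rw [e1, norm_sq_convex_comb, e3, e2, norm_smul, mul_pow, Real.norm_eq_abs, sq_abs]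
  nlinarith [mul_nonneg (sq_nonneg α) (sub_nonneg.2 hsq)]

end MonotoneOperators

/-! ### Strong convexity: minimisers and strong monotonicity -/

section StrongConvexity

variable {E : Type*} [NormedAddCommGroup E] [InnerProductSpace ℝ E]

theorem ConvexOn.add_fderiv_sub_le {g : E → ℝ} (hg : ConvexOn ℝ Set.univ g) {g' : E →L[ℝ] ℝ}
    {x : E} (hx : HasFDerivAt g g' x) (y : E) : g x + g' (y - x) ≤ g y := by
  have hd : HasDerivAt _ _ _ := hx.hasLineDerivAt (y - x)
  have : g' (y - x) ≤ g y - g x := by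
    refine le_of_tendsto hd.tendsto_slope_zero_right ?_
    filter_upwards [Ioo_mem_nhdsGT (zero_lt_one (α := ℝ))] with t ht
    have h := hg.2 (Set.mem_univ x) (Set.mem_univ y) (sub_nonneg.2 ht.2.le) ht.1.le (by ring)
    have e : (1 - t) • x + t • y = x + t • (y - x) := by module
    rw [e] at h
    simp only [zero_add, zero_smul, add_zero, smul_eq_mul] at h ⊢
    rw [inv_mul_le_iff₀ ht.1]
    linarith
  linarith

theorem StrongConvexOn.midpoint_le {g : E → ℝ} {m : ℝ} (hg : StrongConvexOn Set.univ m g)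
    (x y : E) :
    g ((1 / 2 : ℝ) • x + (1 / 2 : ℝ) • y) ≤ g x / 2 + g y / 2 - m / 8 * ‖x - y‖ ^ 2 := by
  obtain ⟨-, h⟩ := hg
  have h := h (Set.mem_univ x) (Set.mem_univ y) (a := 1 / 2) (b := 1 / 2) (by norm_num)
    (by norm_num) (by norm_num)
  simp only [smul_eq_mul] at h
  linarith

/-- Both subgradient inequalities are tested at the midpoint. This gives the modulus `m / 2` instead
of the optimal `m`, which suffices. -/
theorem StrongConvexOn.le_inner_sub_sub {g : E → ℝ} {m : ℝ} (hg : StrongConvexOn Set.univ m g)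
    {x y s s' : E} (hs : ∀ w, g x + ⟪s, w - x⟫ ≤ g w) (hs' : ∀ w, g y + ⟪s', w - y⟫ ≤ g w) :
    m / 2 * ‖x - y‖ ^ 2 ≤ ⟪s - s', x - y⟫ := by
  have h := hg.midpoint_le x y
  have h1 := hs ((1 / 2 : ℝ) • x + (1 / 2 : ℝ) • y)
  have h2 := hs' ((1 / 2 : ℝ) • x + (1 / 2 : ℝ) • y)
  have e1 : (1 / 2 : ℝ) • x + (1 / 2 : ℝ) • y - x = (-(1 / 2) : ℝ) • (x - y) := by module
  have e2 : (1 / 2 : ℝ) • x + (1 / 2 : ℝ) • y - y = (1 / 2 : ℝ) • (x - y) := by module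
  rw [e1, real_inner_smul_right] at h1
  rw [e2, real_inner_smul_right] at h2
  rw [inner_sub_left]
  linarith

theorem StrongConvexOn.exists_isMinOn [FiniteDimensional ℝ E] {g : E → ℝ} {m : ℝ} (hm : 0 < m)
    (hg : StrongConvexOn Set.univ m g) (hd : Differentiable ℝ g) {s : Set E} (hs : IsClosed s)
    (hne : s.Nonempty) : ∃ x ∈ s, IsMinOn g s x := by
  obtain ⟨x₀, hx₀⟩ := hne
  refine hd.continuous.continuousOn.exists_isMinOn' hs hx₀
    (Filter.Eventually.filter_mono inf_le_left ?_)
  have hconv : ConvexOn ℝ Set.univ g := (hg.strictConvexOn hm).convexOn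
  -- The tangent at `x₀`, evaluated at the midpoint, gives `g x ≥ g x₀ + g'(x - x₀) + (m / 4) * ‖x -
  -- x₀‖²`; beyond this radius the quadratic term wins.
  filter_upwards [(tendsto_dist_right_cocompact_atTop x₀).eventually_ge_atTop
    (4 * ‖fderiv ℝ g x₀‖ / m)] with x hx
  rw [dist_eq_norm, div_le_iff₀ hm] at hx
  have h1 := hconv.add_fderiv_sub_le (hd x₀).hasFDerivAt ((1 / 2 : ℝ) • x + (1 / 2 : ℝ) • x₀)
  have e1 : (1 / 2 : ℝ) • x + (1 / 2 : ℝ) • x₀ - x₀ = (1 / 2 : ℝ) • (x - x₀) := by module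
  rw [e1, map_smul, smul_eq_mul] at h1
  have h2 := hg.midpoint_le x x₀
  have h3 : -(‖fderiv ℝ g x₀‖ * ‖x - x₀‖) ≤ fderiv ℝ g x₀ (x - x₀) :=
    neg_le_of_abs_le ((fderiv ℝ g x₀).le_opNorm _)
  nlinarith [mul_le_mul_of_nonneg_right hx (norm_nonneg (x - x₀))]

theorem StrongConvexOn.eq_of_isMinOn {g : E → ℝ} {m : ℝ} (hm : 0 < m)
    (hg : StrongConvexOn Set.univ m g) {s : Set E} (hs : Convex ℝ s) {x y : E} (hx : x ∈ s)
    (hy : y ∈ s) (hxm : IsMinOn g s x) (hym : IsMinOn g s y) : x = y :=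
  ((hg.strictConvexOn hm).subset (Set.subset_univ s) hs).eq_of_isMinOn hxm hym hx hy

end StrongConvexity

/-! ### The `x`-update and nonexpansiveness of the PDMM operator -/

theorem EReal.sum_ne_bot {ι : Type*} {s : Finset ι} {f : ι → EReal} (hf : ∀ i, f i ≠ ⊥) :
    ∑ i ∈ s, f i ≠ ⊥ := by
  classical
  induction s using Finset.induction_on with
  | empty => simp
  | insert j s hj ih =>
    rw [Finset.sum_insert hj, ne_eq, EReal.add_eq_bot_iff, not_or]
    exact ⟨hf j, ih⟩

theorem EReal.sum_coe {ι : Type*} (s : Finset ι) (a : ι → ℝ) :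
    ∑ i ∈ s, (a i : EReal) = ((∑ i ∈ s, a i : ℝ) : EReal) := by
  classical
  induction s using Finset.induction_on with
  | empty => simp
  | insert j s hj ih => rw [Finset.sum_insert hj, Finset.sum_insert hj, ih, EReal.coe_add]

theorem EReal.ne_top_of_sum_ne_top {ι : Type*} {s : Finset ι} {f : ι → EReal}
    (hf : ∀ i, f i ≠ ⊥) (hs : ∑ i ∈ s, f i ≠ ⊤) {i : ι} (hi : i ∈ s) : f i ≠ ⊤ := by
  classical
  intro h
  rw [← Finset.add_sum_erase s f hi, h, EReal.top_add_of_ne_bot (EReal.sum_ne_bot hf)] at hs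
  exact hs rfl

theorem nonneg_of_forall_add_mul_nonneg {A K : ℝ} (h : ∀ t ∈ Set.Ioo (0 : ℝ) 1, 0 ≤ A + t * K) :
    0 ≤ A := by
  have hc : Tendsto (fun t : ℝ => A + t * K) (𝓝[>] 0) (𝓝 (A + 0 * K)) :=
    ((continuous_const.add (continuous_id.mul continuous_const)).tendsto 0).mono_left
      nhdsWithin_le_nhds
  rw [zero_mul, add_zero] at hc
  refine ge_of_tendsto hc ?_
  filter_upwards [Ioo_mem_nhdsGT (zero_lt_one (α := ℝ))] with t ht using h t ht

namespace PDMMProblem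

variable {V : Type*} [Fintype V] {P : PDMMProblem V} {c : ℝ}

theorem exists_cost_eq_coe (hf : ∀ v, IsCCP (P.f v)) : ∃ x, ∃ a : ℝ, P.cost x = a := by
  choose x hx using fun v => (hf v).proper
  refine ⟨WithLp.toLp 2 x, ∑ v, (P.f v (x v)).toReal, ?_⟩
  rw [← EReal.sum_coe]
  exact Finset.sum_congr rfl fun v _ => (EReal.coe_toReal (hx v) ((hf v).ne_bot _)).symm

theorem cost_ne_bot (hf : ∀ v, IsCCP (P.f v)) (x : P.Primal) : P.cost x ≠ ⊥ :=
  EReal.sum_ne_bot fun v => (hf v).ne_bot _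

theorem cost_convex_comb_le (hf : ∀ v, IsCCP (P.f v)) {x y : P.Primal} {a b : ℝ}
    (hx : P.cost x = a) (hy : P.cost y = b) {t : ℝ} (h0 : 0 ≤ t) (h1 : t ≤ 1) :
    P.cost ((1 - t) • x + t • y) ≤ (((1 - t) * a + t * b : ℝ) : EReal) := by
  -- No summand is `⊥`, so a finite total forces every summand to be finite and convexity can be
  -- applied node by node.
  have key : ∀ {x : P.Primal} {a : ℝ}, P.cost x = a →
      ∃ α : V → ℝ, (∀ v, P.f v (x v) = α v) ∧ a = ∑ v, α v := by
    intro x a hx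
    have hv : ∀ v, P.f v (x v) = ((P.f v (x v)).toReal : EReal) := fun v =>
      (EReal.coe_toReal (EReal.ne_top_of_sum_ne_top (s := Finset.univ)
        (f := fun v => P.f v (x v)) (fun v => (hf v).ne_bot _)
        (by change P.cost x ≠ ⊤; rw [hx]; exact EReal.coe_ne_top a) (Finset.mem_univ v))
        ((hf v).ne_bot _)).symm
    refine ⟨_, hv, ?_⟩
    rw [← EReal.coe_eq_coe_iff, ← EReal.sum_coe, ← hx]
    exact Finset.sum_congr rfl fun v _ => hv v
  obtain ⟨α, hα, rfl⟩ := key hx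
  obtain ⟨β, hβ, rfl⟩ := key hy
  rw [Finset.mul_sum, Finset.mul_sum, ← Finset.sum_add_distrib, ← EReal.sum_coe]
  refine Finset.sum_le_sum fun v _ => ?_
  have hmem : ∀ {x : P.Primal} {α : V → ℝ}, P.f v (x v) = α v →
      (x v, α v) ∈ {p : EuclideanSpace ℝ (Fin (P.n v)) × ℝ | P.f v p.1 ≤ (p.2 : EReal)} :=
    fun h => h.le
  exact (hf v).convex (hmem (hα v)) (hmem (hβ v)) (sub_nonneg.2 h1) h0 (by ring)

/-- The part of the objective of the `x`-update besides the cost. -/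
noncomputable def penalty (P : PDMMProblem V) (c : ℝ) (z : P.Aux) (x : P.Primal) : ℝ :=
  ⟪z, P.C x⟫ + c / 2 * ‖P.C x - P.d‖ ^ 2

theorem penalty_add_smul (z : P.Aux) (x h : P.Primal) (t : ℝ) :
    P.penalty c z (x + t • h) = P.penalty c z x + t * ⟪z + c • (P.C x - P.d), P.C h⟫
      + t ^ 2 * (c / 2 * ‖P.C h‖ ^ 2) := by
  have e : P.C (x + t • h) - P.d = (P.C x - P.d) + t • P.C h := by
    rw [map_add, map_smul]
    abel
  rw [penalty, penalty, e, norm_add_sq_real, map_add, map_smul, inner_add_right, inner_add_left,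
    real_inner_smul_right, real_inner_smul_right, real_inner_smul_left, norm_smul, mul_pow,
    Real.norm_eq_abs, sq_abs]
  ring

theorem IsXUpdate.exists_cost_eq_coe (hf : ∀ v, IsCCP (P.f v)) {z : P.Aux} {x : P.Primal}
    (hx : P.IsXUpdate c z x) : ∃ a : ℝ, P.cost x = a := by
  obtain ⟨y, b, hy⟩ := PDMMProblem.exists_cost_eq_coe hf
  refine ⟨(P.cost x).toReal, (EReal.coe_toReal (fun htop => ?_) (cost_ne_bot hf x)).symm⟩
  have h := isMinOn_iff.1 hx y (Set.mem_univ y)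
  rw [htop, EReal.top_add_coe, hy, ← EReal.coe_add, top_le_iff] at h
  exact EReal.coe_ne_top _ h

/-- The optimality condition of the `x`-update. -/
theorem IsXUpdate.neg_adjoint_mem_subdifferential (hf : ∀ v, IsCCP (P.f v)) {z : P.Aux}
    {x : P.Primal} (hx : P.IsXUpdate c z x) :
    -(LinearMap.adjoint P.C (z + c • (P.C x - P.d))) ∈ subdifferential P.cost x := by
  obtain ⟨a, ha⟩ := hx.exists_cost_eq_coe hf
  intro y
  by_cases hy : P.cost y = ⊤
  · rw [hy]
    exact le_top
  lift P.cost y to ℝ using ⟨hy, cost_ne_bot hf y⟩ with b hb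
  rw [ha, ← EReal.coe_add, EReal.coe_le_coe_iff, inner_neg_left, LinearMap.adjoint_inner_left]
  -- Minimality along the segment from `x` to `y`, divided by `t`; the quadratic part of the penalty
  -- vanishes as `t → 0`.
  have : 0 ≤ b - a + ⟪z + c • (P.C x - P.d), P.C (y - x)⟫ := by
    refine nonneg_of_forall_add_mul_nonneg (K := c / 2 * ‖P.C (y - x)‖ ^ 2) fun t ht => ?_
    have h1 := cost_convex_comb_le hf ha hb.symm ht.1.le ht.2.le
    have h2 := isMinOn_iff.1 hx ((1 - t) • x + t • y) (Set.mem_univ _)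
    change P.cost x + (P.penalty c z x : EReal) ≤ _ + (P.penalty c z _ : EReal) at h2
    have h3 := h2.trans (add_le_add_left h1 _)
    have e : (1 - t) • x + t • y = x + t • (y - x) := by module
    rw [ha, ← EReal.coe_add, ← EReal.coe_add, EReal.coe_le_coe_iff, e, penalty_add_smul] at h3
    refine nonneg_of_mul_nonneg_right (a := t) ?_ ht.1
    nlinarith
  linarith

theorem mem_T₁ {μ : P.Aux} {x : P.Primal} {a : ℝ} (hx : P.cost x = a)
    (h : -(LinearMap.adjoint P.C μ) ∈ subdifferential P.cost x) : -(P.C x) + P.d ∈ P.T₁ μ :=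
  ⟨x, mem_subdifferential_conjugate hx h, rfl⟩

/-- Moves the monotonicity gap of `T₁` from the dual variables to the primal ones, where convexity
of the cost acts. -/
theorem inner_T₁_sub (x x' : P.Primal) (μ μ' : P.Aux) :
    ⟪-(P.C x) + P.d - (-(P.C x') + P.d), μ - μ'⟫ =
      ⟪-(LinearMap.adjoint P.C μ) - -(LinearMap.adjoint P.C μ'), x - x'⟫ := by
  have e1 : -(P.C x) + P.d - (-(P.C x') + P.d) = -(P.C (x - x')) := by
    rw [map_sub]
    abel
  have e2 : -(LinearMap.adjoint P.C μ) - -(LinearMap.adjoint P.C μ') =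
      -(LinearMap.adjoint P.C (μ - μ')) := by
    rw [map_sub]
    abel
  rw [e1, e2, inner_neg_left, inner_neg_left, LinearMap.adjoint_inner_left, real_inner_comm]

/-- A single subgradient of the cost makes the conjugate finite somewhere, which excludes the
degenerate subdifferential. -/
theorem isMonotoneOp_T₁ {x : P.Primal} {a : ℝ} (hx : P.cost x = a)
    {v : P.Primal} (hv : v ∈ subdifferential P.cost x) : IsMonotoneOp P.T₁ := by
  rintro μ μ' _ ⟨y, hy, rfl⟩ _ ⟨y', hy', rfl⟩
  rw [inner_T₁_sub, real_inner_comm]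
  refine inner_sub_sub_nonneg_of_mem_subdifferential
    (fun w => ne_bot_of_le_ne_bot (EReal.coe_ne_bot _) (le_conjugate hx w)) ⟨v, ?_⟩ hy hy'
  rw [conjugate_eq_of_mem_subdifferential hx hv]
  exact EReal.coe_ne_top _

theorem isClosed_M {V : Type*} (P : PDMMProblem V) : IsClosed P.M := by
  have hc : ∀ r : P.Coord, Continuous fun μ : P.Aux => (μ r : ℝ) := fun r =>
    (continuous_apply r).comp (PiLp.continuous_ofLp 2 _)
  have h1 : ∀ r : P.Coord, IsClosed {μ : P.Aux | (μ r.swap : ℝ) = μ r} :=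
    fun r => isClosed_eq (hc r.swap) (hc r)
  have h2 : ∀ r : P.Coord, IsClosed {μ : P.Aux | (0 : ℝ) ≤ μ r} :=
    fun r => isClosed_le continuous_const (hc r)
  have e : P.M = (⋂ r : P.Coord, {μ : P.Aux | (μ r.swap : ℝ) = μ r}) ∩
      ⋂ r : P.Coord, ⋂ _ : r.2.1.isLeft = true, {μ : P.Aux | (0 : ℝ) ≤ μ r} := by
    ext μ
    simp only [M, Set.mem_ofPred_eq, Set.mem_inter_iff, Set.mem_iInter]
  rw [e]
  exact (isClosed_iInter h1).inter (isClosed_iInter fun r => isClosed_iInter fun _ => h2 r)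

theorem convex_M {V : Type*} (P : PDMMProblem V) : Convex ℝ P.M := by
  intro μ hμ μ' hμ' a b ha hb _
  refine ⟨fun r => ?_, fun r hr => ?_⟩
  · simp only [PiLp.add_apply, PiLp.smul_apply, hμ.1 r, hμ'.1 r]
  · simp only [PiLp.add_apply, PiLp.smul_apply, smul_eq_mul]
    exact add_nonneg (mul_nonneg ha (hμ.2 r hr)) (mul_nonneg hb (hμ'.2 r hr))

theorem isMonotoneOp_T₂ (P : PDMMProblem V) : IsMonotoneOp P.T₂ := isMonotoneOp_normalCone P.M

theorem lipschitzWith_cayley_T₂ (P : PDMMProblem V) (hc : 0 < c) :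
    LipschitzWith 1 (cayley c P.T₂) := by
  have h0 : (0 : P.Aux) ∈ P.M := ⟨fun _ => rfl, fun _ _ => le_rfl⟩
  exact P.isMonotoneOp_T₂.lipschitzWith_cayley hc
    (exists_mem_normalCone_add_smul ⟨0, h0⟩ P.isClosed_M P.convex_M hc)

/-- The `x`-update at `z` yields the decomposition `z = p + c • u` with `p = z + c • (C x - d)` and
`u = -(C x) + d ∈ T₁ p`, so the resolvent of `T₁` is defined everywhere. -/
theorem lipschitzWith_op (hf : ∀ v, IsCCP (P.f v)) (hc : 0 < c)
    (hx : ∀ z : P.Aux, ∃ x, P.IsXUpdate c z x) : LipschitzWith 1 (P.op c) := by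
  have hmono : IsMonotoneOp P.T₁ := by
    obtain ⟨x, hx0⟩ := hx 0
    obtain ⟨a, ha⟩ := hx0.exists_cost_eq_coe hf
    exact isMonotoneOp_T₁ ha (hx0.neg_adjoint_mem_subdifferential hf)
  have h1 : LipschitzWith 1 (cayley c P.T₁) := hmono.lipschitzWith_cayley hc fun z => by
    obtain ⟨x, hxz⟩ := hx z
    obtain ⟨a, ha⟩ := hxz.exists_cost_eq_coe hf
    exact ⟨_, _, mem_T₁ ha (hxz.neg_adjoint_mem_subdifferential hf),
      by module⟩
  simpa only [op, mul_one] using (P.lipschitzWith_cayley_T₂ hc).comp h1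

theorem avgOp_eq_self {α : ℝ} {z : P.Aux} (hz : P.op c z = z) : P.avgOp c α z = z := by
  rw [avgOp, hz]
  module

end PDMMProblem

/-! ### Asymptotic regularity of averaged operators -/

/-- The stochastic Banach-Picard iteration of an averaged operator with a fixed point is almost
surely asymptotically regular. -/
theorem IsAveraged.ae_tendsto_stochIter_residual {Ω : Type*} [MeasurableSpace Ω] {Pr : Measure Ω}
    [IsProbabilityMeasure Pr] {ι : Type*} [Fintype ι] {α : ℝ}
    {T : EuclideanSpace ℝ ι → EuclideanSpace ℝ ι} (hT : IsAveraged α T)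
    (hfix : (Function.fixedPoints T).Nonempty) {U : ℕ → Ω → ι → ℝ} (hU : IsMaskProcess Pr U)
    (z₀ : EuclideanSpace ℝ ι) :
    ∀ᵐ ω ∂Pr, Tendsto
      (fun k => stochIter T U z₀ k ω - T (stochIter T U z₀ k ω)) atTop (𝓝 0) := by
  obtain ⟨y, hy⟩ := hfix
  have hTy : ∀ z, ‖T z - y‖ ≤ ‖z - y‖ := fun z => by
    have h := hT.lipschitzWith.dist_le_mul z y
    rwa [NNReal.coe_one, one_mul, dist_eq_norm, dist_eq_norm, hy.eq] at h
  filter_upwards [ae_tendsto_norm_sq_sub_norm_sq_stochIter hU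
    hT.lipschitzWith.continuous.measurable hTy z₀] with ω hω
  have h1 : 0 < 1 - α := sub_pos.2 hT.2.1
  have h2 : Tendsto (fun k => ‖stochIter T U z₀ k ω - T (stochIter T U z₀ k ω)‖ ^ 2) atTop
      (𝓝 0) := by
    refine squeeze_zero (fun _ => sq_nonneg _) (fun k => ?_)
      (by simpa using hω.const_mul (α / (1 - α)))
    rw [div_mul_eq_mul_div, le_div_iff₀ h1, mul_comm]
    exact hT.norm_sq_residual_le hy.eq _
  rw [tendsto_zero_iff_norm_tendsto_zero]
  simpa using h2.sqrt

/-! ### Edge coordinates, feasibility and Lagrange multipliers -/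

namespace PDMMProblem

theorem Coord.swap_swap {V : Type*} {P : PDMMProblem V} (r : P.Coord) : r.swap.swap = r := by
  obtain ⟨e, l, v, hv⟩ := r
  have h : Sym2.Mem.other (Sym2.other_mem hv) = v := Sym2.other_invol hv (Sym2.other_mem hv)
  simp only [Coord.swap, h]

theorem Coord.adj {V : Type*} {P : PDMMProblem V} (r : P.Coord) : P.G.Adj r.nbr r.node := by
  have h := r.1.2
  rw [← Sym2.other_spec r.2.2.2] at h
  exact (SimpleGraph.mem_edgeSet _).1 h |>.symm

theorem Coord.swap_mk {V : Type*} {P : PDMMProblem V} {i j : V} (h : P.G.Adj i j)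
    (l : Fin (P.mI s(i, j)) ⊕ Fin (P.mE s(i, j))) :
    Coord.swap (P := P) ⟨⟨s(i, j), h⟩, l, ⟨i, Sym2.mem_mk_left i j⟩⟩ =
      ⟨⟨s(i, j), h⟩, l, ⟨j, Sym2.mem_mk_right i j⟩⟩ := by
  have h' : Sym2.Mem.other (Sym2.mem_mk_left i j) = j :=
    Sym2.congr_right.1 (Sym2.other_spec (Sym2.mem_mk_left i j))
  simp only [Coord.swap, h']

theorem Coord.exists_eq_mk {V : Type*} {P : PDMMProblem V} (r : P.Coord) :
    ∃ (i j : V) (h : P.G.Adj i j) (l : Fin (P.mI s(i, j)) ⊕ Fin (P.mE s(i, j))),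
      r = ⟨⟨s(i, j), h⟩, l, ⟨i, Sym2.mem_mk_left i j⟩⟩ := by
  obtain ⟨⟨e, he⟩, l, v, hv⟩ := r
  obtain ⟨w, hw⟩ := id hv
  subst hw
  exact ⟨v, w, he, l, rfl⟩

variable {V : Type*} [Fintype V] {P : PDMMProblem V} {c : ℝ}

/-- As `d` carries half of `b`, adding the entries of `C x - d` at a coordinate and at its mirror
image gives the residual of the scalar constraint. -/
theorem feasible_iff {V : Type*} {P : PDMMProblem V} {x : P.Primal} :
    P.Feasible x ↔ ∀ r : P.Coord,
      (P.C x - P.d) r + (P.C x - P.d) r.swap ≤ 0 ∧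
      (r.2.1.isLeft = false → 0 ≤ (P.C x - P.d) r + (P.C x - P.d) r.swap) := by
  have key : ∀ {i j : V} (h : P.G.Adj i j) (l : Fin (P.mI s(i, j)) ⊕ Fin (P.mE s(i, j))),
      (P.C x - P.d) (⟨⟨s(i, j), h⟩, l, ⟨i, Sym2.mem_mk_left i j⟩⟩ : P.Coord) +
        (P.C x - P.d) (⟨⟨s(i, j), h⟩, l, ⟨j, Sym2.mem_mk_right i j⟩⟩ : P.Coord) =
      ((P.A s(i, j) i).mulVec (x i).ofLp + (P.A s(i, j) j).mulVec (x j).ofLp) l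
        - P.b s(i, j) l := by
    intro i j h l
    change ((P.A s(i, j) i).mulVec (x i).ofLp l - P.b s(i, j) l / 2) +
      ((P.A s(i, j) j).mulVec (x j).ofLp l - P.b s(i, j) l / 2) = _
    rw [Pi.add_apply]
    ring
  constructor
  · intro hx r
    obtain ⟨i, j, h, l, rfl⟩ := r.exists_eq_mk
    rw [Coord.swap_mk, key h l]
    rcases l with l | l
    · exact ⟨sub_nonpos.2 ((hx i j h).1 l), fun hl => by simp at hl⟩
    · have := (hx i j h).2 l
      exact ⟨sub_nonpos.2 this.le, fun _ => sub_nonneg.2 this.ge⟩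
  · intro hx i j h
    refine ⟨fun l => ?_, fun l => ?_⟩
    · have := (hx ⟨⟨s(i, j), h⟩, Sum.inl l, ⟨i, Sym2.mem_mk_left i j⟩⟩).1
      rw [Coord.swap_mk, key h] at this
      exact sub_nonpos.1 this
    · have := hx ⟨⟨s(i, j), h⟩, Sum.inr l, ⟨i, Sym2.mem_mk_left i j⟩⟩
      rw [Coord.swap_mk, key h] at this
      exact le_antisymm (sub_nonpos.1 this.1) (sub_nonneg.1 (this.2 rfl))

theorem sum_mul_add_swap (a b : P.Coord → ℝ) :
    ∑ r, a r * (b r + b r.swap) = ∑ r, (a r + a r.swap) * b r := by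
  have hswap : ∑ r : P.Coord, a r * b r.swap = ∑ r : P.Coord, a r.swap * b r := by
    have hinv : Function.Involutive (Coord.swap (P := P)) := Coord.swap_swap
    rw [← Equiv.sum_comp hinv.toPerm]
    refine Finset.sum_congr rfl fun r _ => ?_
    rw [Function.Involutive.coe_toPerm, Coord.swap_swap]
  simp only [mul_add, add_mul, Finset.sum_add_distrib, hswap]

theorem inner_eq_sum (u v : P.Aux) : ⟪u, v⟫ = ∑ r, u r * v r := by
  rw [PiLp.inner_apply]
  exact Finset.sum_congr rfl fun r _ => by simp [mul_comm]

/-- Symmetry of `u` turns twice the inner product into the sum of `u r` times the constraint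
residuals; equality rows contribute 0 and inequality rows have `u r ≥ 0`. -/
theorem Feasible.inner_nonpos {x : P.Primal} (hx : P.Feasible x) {u : P.Aux} (hu : u ∈ P.M) :
    ⟪P.C x - P.d, u⟫ ≤ 0 := by
  have h : ∑ r : P.Coord, u r * ((P.C x - P.d) r + (P.C x - P.d) r.swap) =
      ∑ r : P.Coord, (u r + u r.swap) * (P.C x - P.d) r :=
    sum_mul_add_swap (fun r => u r) fun r => (P.C x - P.d) r
  have h' : ∑ r : P.Coord, (u r + u r.swap) * (P.C x - P.d) r = 2 * ⟪P.C x - P.d, u⟫ := by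
    rw [inner_eq_sum, Finset.mul_sum]
    refine Finset.sum_congr rfl fun r _ => ?_
    rw [hu.1 r]
    ring
  have hnonpos : ∑ r : P.Coord, u r * ((P.C x - P.d) r + (P.C x - P.d) r.swap) ≤ 0 := by
    refine Finset.sum_nonpos fun r _ => ?_
    have hr := feasible_iff.1 hx r
    cases hl : r.2.1.isLeft
    · rw [le_antisymm hr.1 (hr.2 hl), mul_zero]
    · exact mul_nonpos_of_nonneg_of_nonpos (hu.2 r hl) hr.1
  linarith

theorem isClosed_feasible (P : PDMMProblem V) : IsClosed {x | P.Feasible x} := by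
  have hC : Continuous fun x => P.C x - P.d :=
    (LinearMap.continuous_of_finiteDimensional P.C).sub continuous_const
  have hc : ∀ r : P.Coord, Continuous fun x : P.Primal => ((P.C x - P.d) r : ℝ) := fun r =>
    (EuclideanSpace.proj (𝕜 := ℝ) r).continuous.comp hC
  simp only [feasible_iff]
  have e : {x : P.Primal | ∀ r : P.Coord, (P.C x - P.d) r + (P.C x - P.d) r.swap ≤ 0 ∧
      (r.2.1.isLeft = false → 0 ≤ (P.C x - P.d) r + (P.C x - P.d) r.swap)} =
      ⋂ r : P.Coord, {x : P.Primal | (P.C x - P.d) r + (P.C x - P.d) r.swap ≤ 0} ∩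
        ⋂ _ : r.2.1.isLeft = false,
          {x : P.Primal | 0 ≤ (P.C x - P.d) r + (P.C x - P.d) r.swap} := by
    ext x
    simp only [Set.mem_ofPred_eq, Set.mem_iInter, Set.mem_inter_iff]
  rw [e]
  exact isClosed_iInter fun r => (isClosed_le ((hc _).add (hc _)) continuous_const).inter
    (isClosed_iInter fun _ => isClosed_le continuous_const ((hc _).add (hc _)))

theorem convex_feasible {V : Type*} (P : PDMMProblem V) : Convex ℝ {x | P.Feasible x} := by
  intro x hx y hy a b ha hb hab
  rw [Set.mem_ofPred_eq, feasible_iff] at hx hy ⊢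
  intro r
  have e : ∀ r : P.Coord, (P.C (a • x + b • y) - P.d) r =
      a * (P.C x - P.d) r + b * (P.C y - P.d) r := by
    intro r
    have : P.C (a • x + b • y) - P.d = a • (P.C x - P.d) + b • (P.C y - P.d) := by
      rw [map_add, map_smul, map_smul]
      linear_combination (norm := module) hab • P.d
    rw [this, PiLp.add_apply, PiLp.smul_apply, PiLp.smul_apply, smul_eq_mul, smul_eq_mul]
  rw [e, e]
  have h1 := (hx r).1
  have h2 := (hy r).1
  refine ⟨by nlinarith, fun hl => ?_⟩
  have h3 := (hx r).2 hl
  have h4 := (hy r).2 hl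
  nlinarith

/-- Existence of Lagrange multipliers for a differentiable cost. -/
theorem exists_multiplier {g : P.Primal → ℝ} {x : P.Primal} (hg : DifferentiableAt ℝ g x)
    (hx : P.Feasible x) (hmin : ∀ y, P.Feasible y → g x ≤ g y) :
    ∃ μ ∈ P.M, P.C x - P.d ∈ P.T₂ μ ∧ ∀ h, fderiv ℝ g x h = ⟪-(LinearMap.adjoint P.C μ), h⟫ := by
  classical
  let row : P.Coord → P.Primal →ₗ[ℝ] ℝ := fun r =>
    (EuclideanSpace.proj (𝕜 := ℝ) r : P.Aux →L[ℝ] ℝ).toLinearMap ∘ₗ P.C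
      + (EuclideanSpace.proj (𝕜 := ℝ) r.swap : P.Aux →L[ℝ] ℝ).toLinearMap ∘ₗ P.C
  have hrow : ∀ r y, row r y = P.C y r + P.C y r.swap := fun r y => rfl
  -- Each row occurs twice, indexed by a `Bool`. For an equality row the second copy is the reversed
  -- inequality; for an inequality row it is the vacuous `0 ≤ 0`.
  let σ : P.Coord → ℝ := fun r => if r.2.1.isLeft then 0 else -1
  let a : P.Coord × Bool → P.Primal →ₗ[ℝ] ℝ := fun q => (if q.2 then 1 else σ q.1) • row q.1
  let β : P.Coord × Bool → ℝ := fun q => (if q.2 then 1 else σ q.1) * (P.d q.1 + P.d q.1.swap)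
  have hres : ∀ q y, a q y - β q = (if q.2 then 1 else σ q.1) *
      ((P.C y - P.d) q.1 + (P.C y - P.d) q.1.swap) := by
    intro q y
    change (if q.2 then 1 else σ q.1) * (P.C y q.1 + P.C y q.1.swap) -
      (if q.2 then 1 else σ q.1) * (P.d q.1 + P.d q.1.swap) =
      (if q.2 then 1 else σ q.1) * ((P.C y q.1 - P.d q.1) + (P.C y q.1.swap - P.d q.1.swap))
    ring
  have hfeas : ∀ y, P.Feasible y ↔ ∀ q, a q y ≤ β q := by
    intro y
    rw [feasible_iff]
    constructor
    · rintro hy ⟨r, s⟩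
      rw [← sub_nonpos, hres]
      cases s
      · cases hl : r.2.1.isLeft
        · have e : σ r = -1 := by simp [σ, hl]
          rw [if_neg Bool.false_ne_true, e, neg_one_mul, neg_nonpos]
          exact (hy r).2 hl
        · simp [σ, hl]
      · simpa using (hy r).1
    · intro hy r
      have h1 := sub_nonpos.2 (hy (r, true))
      have h2 := sub_nonpos.2 (hy (r, false))
      rw [hres] at h1 h2
      refine ⟨by simpa using h1, fun hl => ?_⟩
      have e : σ r = -1 := by simp [σ, hl]
      rwa [if_neg Bool.false_ne_true, e, neg_one_mul, neg_nonpos] at h2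
  obtain ⟨w, hw, hwg, hwc⟩ := exists_multipliers_of_isMinOn_polyhedron a β hg.hasFDerivAt
    ((hfeas x).1 hx) fun y hy => hmin y ((hfeas y).2 hy)
  let ν : P.Coord → ℝ := fun r => w (r, true) + σ r * w (r, false)
  have hν : ∀ b : P.Coord → ℝ, ∑ q : P.Coord × Bool, w q * ((if q.2 then 1 else σ q.1) *
      (b q.1 + b q.1.swap)) = ∑ r, (ν r + ν r.swap) * b r := by
    intro b
    rw [← sum_mul_add_swap, Fintype.sum_prod_type]
    refine Finset.sum_congr rfl fun r _ => ?_
    simp [ν]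
    ring
  -- Symmetrising the signed multiplier `ν` puts it into `M`; by `hν` the two copies of each
  -- constraint are thereby merged.
  let μ : P.Aux := WithLp.toLp 2 fun r => ν r + ν r.swap
  have hinner : ∀ v : P.Aux, ⟪μ, v⟫ = ∑ r, (ν r + ν r.swap) * v r := fun v => inner_eq_sum _ _
  have hcs : ⟪P.C x - P.d, μ⟫ = 0 := by
    rw [real_inner_comm, hinner, ← hν]
    refine Finset.sum_eq_zero fun q _ => ?_
    rw [← hres]
    exact hwc q
  have hμ : μ ∈ P.M := by
    refine ⟨fun r => ?_, fun r hr => ?_⟩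
    · change ν r.swap + ν r.swap.swap = ν r + ν r.swap
      rw [Coord.swap_swap, add_comm]
    · have hr' : r.swap.2.1.isLeft = true := hr
      change 0 ≤ (w (r, true) + σ r * w (r, false)) +
        (w (r.swap, true) + σ r.swap * w (r.swap, false))
      simp only [σ, hr, hr', if_true, zero_mul, add_zero]
      exact add_nonneg (hw _) (hw _)
  refine ⟨μ, hμ, ⟨hμ, fun u hu => ?_⟩, fun h => ?_⟩
  · rw [inner_sub_right, hcs, sub_zero]
    exact hx.inner_nonpos hu
  · rw [inner_neg_left, LinearMap.adjoint_inner_left, hinner, ← hν, ← neg_eq_iff_eq_neg]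
    exact hwg h


/-! ### Primal convergence for strongly convex costs -/

theorem isXUpdate_iff {g : P.Primal → ℝ} (hg : ∀ x, P.cost x = (g x : EReal)) {z : P.Aux}
    {x : P.Primal} :
    P.IsXUpdate c z x ↔ IsMinOn (fun x => g x + P.penalty c z x) Set.univ x := by
  simp only [IsXUpdate, isMinOn_iff, hg, ← EReal.coe_add, EReal.coe_le_coe_iff, penalty]

theorem convexOn_penalty (hc : 0 < c) (z : P.Aux) : ConvexOn ℝ Set.univ (P.penalty c z) := by
  refine ⟨convex_univ, fun x _ y _ a b ha hb hab => ?_⟩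
  obtain rfl : a = 1 - b := by linarith
  have e1 : P.C ((1 - b) • x + b • y) - P.d = (1 - b) • (P.C x - P.d) + b • (P.C y - P.d) := by
    rw [map_add, map_smul, map_smul]
    module
  have e2 : ⟪z, P.C ((1 - b) • x + b • y)⟫ = (1 - b) * ⟪z, P.C x⟫ + b * ⟪z, P.C y⟫ := by
    rw [map_add, map_smul, map_smul, inner_add_right, real_inner_smul_right, real_inner_smul_right]
  have h := mul_nonneg (mul_nonneg hc.le (mul_nonneg hb ha))
    (sq_nonneg ‖P.C x - P.d - (P.C y - P.d)‖)
  rw [penalty, penalty, penalty, e1, e2, norm_sq_convex_comb, smul_eq_mul, smul_eq_mul]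
  nlinarith

theorem differentiable_penalty (z : P.Aux) : Differentiable ℝ (P.penalty c z) := by
  have hC : Differentiable ℝ fun x => P.C x := (LinearMap.toContinuousLinearMap P.C).differentiable
  exact ((differentiable_const z).inner ℝ hC).add
    (((hC.sub (differentiable_const _)).norm_sq ℝ).const_mul _)

theorem IsDiffStronglyConvex.existsUnique_isXUpdate (hP : P.IsDiffStronglyConvex) (hc : 0 < c)
    (z : P.Aux) : ∃! x, P.IsXUpdate c z x := by
  obtain ⟨g, hg, hd, m, hm, hgm⟩ := hP
  simp only [isXUpdate_iff hg]
  have hconv : StrongConvexOn Set.univ m fun x => g x + P.penalty c z x := by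
    rw [strongConvexOn_iff_convex] at hgm ⊢
    refine (hgm.add (convexOn_penalty hc z)).congr fun x _ => ?_
    simp only [Pi.add_apply]
    ring
  obtain ⟨x, -, hx⟩ := hconv.exists_isMinOn hm (hd.add (differentiable_penalty z)) isClosed_univ
    Set.univ_nonempty
  exact ⟨x, hx, fun y hy =>
    hconv.eq_of_isMinOn hm convex_univ (Set.mem_univ y) (Set.mem_univ x) hy hx⟩

theorem isSolution_iff {g : P.Primal → ℝ} (hg : ∀ x, P.cost x = (g x : EReal)) {x : P.Primal} :
    P.IsSolution x ↔ P.Feasible x ∧ IsMinOn g {x | P.Feasible x} x := by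
  simp only [IsSolution, isMinOn_iff, hg, EReal.coe_le_coe_iff, Set.mem_ofPred_eq]

/-- If `x` is optimal with multiplier `μ`, then `μ + c (d - C x)` is a fixed point of the IEQ-PDMM
operator. -/
theorem op_eq_self (hc : 0 < c) (hmono : IsMonotoneOp P.T₁) {μ : P.Aux} {x : P.Primal}
    (h1 : -(P.C x) + P.d ∈ P.T₁ μ) (h2 : P.C x - P.d ∈ P.T₂ μ) :
    P.op c (μ + c • (-(P.C x) + P.d)) = μ + c • (-(P.C x) + P.d) := by
  have e : μ - c • (-(P.C x) + P.d) = μ + c • (P.C x - P.d) := by module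
  rw [op, Function.comp_apply, hmono.cayley_eq hc h1, e, P.isMonotoneOp_T₂.cayley_eq hc h2]
  module

/-- The reflection in `T₁` loses exactly `4 * c` times the monotonicity gap, the reflection in `T₂`
is nonexpansive, and averaging scales the loss by `α`. Nothing requires `α < 1`. -/
theorem norm_sq_avgOp_sub_le (hc : 0 < c) (hmono : IsMonotoneOp P.T₁) {α : ℝ} (h0 : 0 < α)
    (h1 : α ≤ 1) {μ μ' : P.Aux} {x x' : P.Primal} (hx : -(P.C x) + P.d ∈ P.T₁ μ)
    (hx' : -(P.C x') + P.d ∈ P.T₁ μ') {z' : P.Aux} (hz' : z' = μ' + c • (-(P.C x') + P.d))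
    (hfix : P.op c z' = z') :
    ‖P.avgOp c α (μ + c • (-(P.C x) + P.d)) - z'‖ ^ 2 ≤
      ‖μ + c • (-(P.C x) + P.d) - z'‖ ^ 2 - 4 * c * α *
        ⟪-(LinearMap.adjoint P.C μ) - -(LinearMap.adjoint P.C μ'), x - x'⟫ := by
  set z := μ + c • (-(P.C x) + P.d) with hz
  have hop : ‖P.op c z - z'‖ ^ 2 ≤ ‖z - z'‖ ^ 2 - 4 * c *
      ⟪-(LinearMap.adjoint P.C μ) - -(LinearMap.adjoint P.C μ'), x - x'⟫ := by
    have h := (P.lipschitzWith_cayley_T₂ hc).dist_le_mul (cayley c P.T₁ z) (cayley c P.T₁ z')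
    rw [NNReal.coe_one, one_mul, dist_eq_norm, dist_eq_norm] at h
    change ‖P.op c z - P.op c z'‖ ≤ _ at h
    rw [hfix] at h
    refine (pow_le_pow_left₀ (norm_nonneg _) h 2).trans (le_of_eq ?_)
    rw [hz, hz', hmono.cayley_eq hc hx, hmono.cayley_eq hc hx', norm_sq_reflected_sub,
      inner_T₁_sub]
  have e : P.avgOp c α z - z' = (1 - α) • (z - z') + α • (P.op c z - z') := by
    rw [avgOp]
    module
  rw [e, norm_sq_convex_comb]
  have := mul_nonneg (mul_nonneg h0.le (sub_nonneg.2 h1)) (sq_nonneg ‖z - z' - (P.op c z - z')‖)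
  nlinarith [mul_le_mul_of_nonneg_left hop h0.le]

theorem lipschitzWith_avgOp {α : ℝ} (h0 : 0 < α) (h1 : α ≤ 1) (hop : LipschitzWith 1 (P.op c)) :
    LipschitzWith 1 (P.avgOp c α) := by
  refine LipschitzWith.of_dist_le_mul fun z z' => ?_
  have h := hop.dist_le_mul z z'
  rw [NNReal.coe_one, one_mul, dist_eq_norm, dist_eq_norm] at h ⊢
  have : P.avgOp c α z - P.avgOp c α z' = (1 - α) • (z - z') + α • (P.op c z - P.op c z') := by
    rw [avgOp, avgOp]
    module
  rw [this]
  refine (norm_add_le _ _).trans ?_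
  rw [norm_smul, norm_smul, Real.norm_of_nonneg h0.le, Real.norm_of_nonneg (sub_nonneg.2 h1)]
  nlinarith

/-- Almost sure primal convergence of stochastic IEQ-PDMM for a differentiable strongly convex
cost. -/
theorem IsDiffStronglyConvex.exists_solution_and_ae_tendsto (hf : ∀ v, IsCCP (P.f v)) (hc : 0 < c)
    (hP : P.IsDiffStronglyConvex) (hne : ∃ x, P.Feasible x)
    {Ω : Type*} [MeasurableSpace Ω] (Pr : Measure Ω) [IsProbabilityMeasure Pr] :
    ∃ xstar : P.Primal, (∀ x, P.IsSolution x ↔ x = xstar) ∧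
      ∀ α : ℝ, 0 < α → α ≤ 1 →
      ∀ (U : ℕ → Ω → P.Coord → ℝ), IsMaskProcess Pr U → ∀ z₀ : P.Aux,
      ∀ X : ℕ → Ω → P.Primal,
        (∀ k ω, P.IsXUpdate c (stochIter (P.avgOp c α) U z₀ k ω) (X (k + 1) ω)) →
        ∀ᵐ ω ∂Pr, Tendsto (fun k => X k ω) atTop (𝓝 xstar) := by
  have hupd : ∀ z : P.Aux, ∃ x, P.IsXUpdate c z x :=
    fun z => (hP.existsUnique_isXUpdate hc z).exists
  obtain ⟨g, hg, hd, m, hm, hgm⟩ := hP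
  obtain ⟨x', hx', hmin⟩ := hgm.exists_isMinOn hm hd P.isClosed_feasible hne
  refine ⟨x', fun x => ?_, ?_⟩
  · rw [isSolution_iff hg]
    constructor
    · rintro ⟨hx, hxm⟩
      exact hgm.eq_of_isMinOn hm P.convex_feasible hx hx' hxm hmin
    · rintro rfl
      exact ⟨hx', hmin⟩
  obtain ⟨μ', -, hμT, hμg⟩ := exists_multiplier (hd x') hx' fun y hy => isMinOn_iff.1 hmin y hy
  have hreal : ∀ {x s : P.Primal}, s ∈ subdifferential P.cost x → ∀ w, g x + ⟪s, w - x⟫ ≤ g w := by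
    intro x s hs w
    have h := hs w
    rwa [hg, hg, ← EReal.coe_add, EReal.coe_le_coe_iff] at h
  have hsub' : -(LinearMap.adjoint P.C μ') ∈ subdifferential P.cost x' := by
    intro w
    rw [hg, hg, ← EReal.coe_add, EReal.coe_le_coe_iff, ← hμg]
    exact (hgm.strictConvexOn hm).convexOn.add_fderiv_sub_le (hd x').hasFDerivAt w
  have hmono : IsMonotoneOp P.T₁ := isMonotoneOp_T₁ (hg x') hsub'
  have hT₁' := mem_T₁ (hg x') hsub'
  have hfix := op_eq_self hc hmono hT₁' hμT
  set z' := μ' + c • (-(P.C x') + P.d) with hz'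
  intro α h0 h1 U hU z₀ X hX
  have hLip := lipschitzWith_avgOp h0 h1 (lipschitzWith_op hf hc hupd)
  have hquasi : ∀ z, ‖P.avgOp c α z - z'‖ ≤ ‖z - z'‖ := fun z => by
    have h := hLip.dist_le_mul z z'
    rwa [NNReal.coe_one, one_mul, dist_eq_norm, dist_eq_norm, avgOp_eq_self hfix] at h
  -- The constant is `4 * c * α` times the modulus `m / 2` of strong monotonicity.
  have hdecr : ∀ z x, P.IsXUpdate c z x → 2 * c * α * m * ‖x - x'‖ ^ 2 ≤
      ‖z - z'‖ ^ 2 - ‖P.avgOp c α z - z'‖ ^ 2 := by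
    intro z x hx
    have hsub := hx.neg_adjoint_mem_subdifferential hf
    have h := norm_sq_avgOp_sub_le hc hmono h0 h1 (mem_T₁ (hg x) hsub) hT₁' hz' hfix
    have e : z + c • (P.C x - P.d) + c • (-(P.C x) + P.d) = z := by module
    rw [e] at h
    have hs := hgm.le_inner_sub_sub (hreal hsub) (hreal hsub')
    nlinarith [mul_le_mul_of_nonneg_left hs (mul_pos hc h0).le]
  filter_upwards [ae_tendsto_norm_sq_sub_norm_sq_stochIter hU hLip.continuous.measurable hquasi z₀]
    with ω hω
  -- `X 0` is arbitrary; only the shifted sequence consists of `x`-updates.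
  rw [← tendsto_add_atTop_iff_nat 1, tendsto_iff_norm_sub_tendsto_zero]
  have hpos : 0 < 2 * c * α * m := by positivity
  have h2 : Tendsto (fun k => ‖X (k + 1) ω - x'‖ ^ 2) atTop (𝓝 0) := by
    refine squeeze_zero (fun _ => sq_nonneg _) (fun k => ?_)
      (by simpa only [zero_div] using hω.div_const (2 * c * α * m))
    rw [le_div_iff₀ hpos, mul_comm]
    exact hdecr _ _ (hX k ω)
  simpa using h2.sqrt

end PDMMProblem

/-! ### Masks from random node and edge sets -/

theorem IsIID.comp {Ω β γ : Type*} [MeasurableSpace Ω] [MeasurableSpace β] [MeasurableSpace γ]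
    {Pr : Measure Ω} {X : ℕ → Ω → β} (hX : IsIID Pr X) {φ : β → γ} (hφ : Measurable φ) :
    IsIID Pr fun k ω => φ (X k ω) where
  measurable k := hφ.comp (hX.measurable k)
  indep := hX.indep.comp (fun _ => φ) fun _ => hφ
  ident k := (hX.ident k).comp hφ

/-- All three masks are indicators of a measurable property of one i.i.d. process. Giving `U` by two
implications avoids any dependence on a decidability instance. -/
theorem IsIID.isMaskProcess {Ω β ι : Type*} [MeasurableSpace Ω] [MeasurableSpace β]
    {Pr : Measure Ω} {X : ℕ → Ω → β} (hX : IsIID Pr X) {p : ι → β → Prop}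
    (hp : ∀ r, MeasurableSet {b | p r b}) (hpos : ∀ r, 0 < Pr {ω | p r (X 1 ω)})
    {U : ℕ → Ω → ι → ℝ} (h1 : ∀ k ω r, p r (X k ω) → U k ω r = 1)
    (h0 : ∀ k ω r, ¬p r (X k ω) → U k ω r = 0) : IsMaskProcess Pr U := by
  classical
  obtain rfl : U = fun k ω r => if p r (X k ω) then (1 : ℝ) else 0 := by
    ext k ω r
    split_ifs with h
    exacts [h1 k ω r h, h0 k ω r h]
  refine ⟨hX.comp (φ := fun b r => if p r b then (1 : ℝ) else 0)
    (measurable_pi_lambda _ fun r => Measurable.ite (hp r) measurable_const measurable_const),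
    fun k ω r => ?_, fun r => by simpa using hpos r⟩
  by_cases h : p r (X k ω)
  exacts [Or.inr (h1 k ω r h), Or.inl (h0 k ω r h)]

theorem mainTheorem5 {V : Type*} [Fintype V] (P : PDMMProblem V) (hf : ∀ v, IsCCP (P.f v))
    (c : ℝ) (hc : 0 < c)
    {Ω : Type*} [MeasurableSpace Ω] (Pr : Measure Ω) [IsProbabilityMeasure Pr] :
    -- every averaged operator with a fixed point
    (∀ (α : ℝ) (T : P.Aux → P.Aux), IsAveraged α T → (Function.fixedPoints T).Nonempty →
      ∀ (U : ℕ → Ω → P.Coord → ℝ), IsMaskProcess Pr U → ∀ z₀ : P.Aux,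
        ∀ᵐ ω ∂Pr, Tendsto
          (fun k => stochIter T U z₀ k ω - T (stochIter T U z₀ k ω)) atTop (𝓝 0)) ∧
    -- averaged IEQ-PDMM
    ((∀ z : P.Aux, ∃ x, P.IsXUpdate c z x) → (Function.fixedPoints (P.op c)).Nonempty →
      ∀ α : ℝ, 0 < α → α < 1 →
        IsAveraged α (P.avgOp c α) ∧
        ∀ (U : ℕ → Ω → P.Coord → ℝ), IsMaskProcess Pr U → ∀ z₀ : P.Aux,
          ∀ᵐ ω ∂Pr, Tendsto
            (fun k => stochIter (P.avgOp c α) U z₀ k ω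
              - P.avgOp c α (stochIter (P.avgOp c α) U z₀ k ω)) atTop (𝓝 0)) ∧
    -- primal convergence, with or without averaging
    (P.IsDiffStronglyConvex → (∃ x, P.Feasible x) →
      (∀ z : P.Aux, ∃! x, P.IsXUpdate c z x) ∧
      ∃ xstar : P.Primal, (∀ x, P.IsSolution x ↔ x = xstar) ∧
        ∀ α : ℝ, 0 < α → α ≤ 1 →
        ∀ (U : ℕ → Ω → P.Coord → ℝ), IsMaskProcess Pr U → ∀ z₀ : P.Aux,
        ∀ X : ℕ → Ω → P.Primal,
          (∀ k ω, P.IsXUpdate c (stochIter (P.avgOp c α) U z₀ k ω) (X (k + 1) ω)) →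
          ∀ᵐ ω ∂Pr, Tendsto (fun k => X k ω) atTop (𝓝 xstar)) ∧
    -- asynchronous updating
    (∀ ζ : ℕ → Ω → Set V, IsIID Pr ζ →
      (∀ i j, P.G.Adj i j → 0 < Pr {ω | i ∈ ζ 1 ω}) →
      IsMaskProcess Pr (asyncMask P ζ)) ∧
    -- transmission losses
    (∀ η : ℕ → Ω → Set (V × V), IsIID Pr η →
      (∀ i j, P.G.Adj i j → 0 < Pr {ω | (i, j) ∈ η 1 ω}) →
      IsMaskProcess Pr (lossMask P η)) ∧
    -- both
    (∀ (ζ : ℕ → Ω → Set V) (η : ℕ → Ω → Set (V × V)), IsIID Pr (fun k ω => (ζ k ω, η k ω)) →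
      (∀ i j, P.G.Adj i j → 0 < Pr {ω | i ∈ ζ 1 ω ∧ (i, j) ∈ η 1 ω}) →
      IsMaskProcess Pr (lossyAsyncMask P ζ η)) := by
  refine ⟨fun α T hT hfix U hU z₀ => hT.ae_tendsto_stochIter_residual hfix hU z₀,
    fun hupd hfix α h0 h1 => ?_,
    fun hP hne => ⟨hP.existsUnique_isXUpdate hc, hP.exists_solution_and_ae_tendsto hf hc hne Pr⟩,
    fun ζ hζ hpos => ?_, fun η hη hpos => ?_, fun ζ η hζη hpos => ?_⟩
  · have havg : IsAveraged α (P.avgOp c α) :=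
      ⟨h0, h1, P.op c, PDMMProblem.lipschitzWith_op hf hc hupd, fun _ => rfl⟩
    obtain ⟨z, hz⟩ := hfix
    exact ⟨havg, fun U hU z₀ => havg.ae_tendsto_stochIter_residual
      ⟨z, PDMMProblem.avgOp_eq_self hz⟩ hU z₀⟩
  -- Every coordinate lies on an edge (`r.adj`), so positivity is needed only at nodes that have a
  -- neighbour.
  · exact hζ.isMaskProcess (p := fun (r : P.Coord) s => r.nbr ∈ s)
      (fun r => measurableSet_setOfPred.2 (measurable_set_mem _)) (fun r => hpos _ _ r.adj)
      (fun _ _ _ h => if_pos h) fun _ _ _ h => if_neg h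
  · exact hη.isMaskProcess (p := fun (r : P.Coord) s => (r.nbr, r.node) ∈ s)
      (fun r => measurableSet_setOfPred.2 (measurable_set_mem _)) (fun r => hpos _ _ r.adj)
      (fun _ _ _ h => if_pos h) fun _ _ _ h => if_neg h
  · exact hζη.isMaskProcess
      (p := fun (r : P.Coord) s => r.nbr ∈ s.1 ∧ (r.nbr, r.node) ∈ s.2)
      (fun r => (measurableSet_setOfPred.2 ((measurable_set_mem _).comp measurable_fst)).inter
        (measurableSet_setOfPred.2 ((measurable_set_mem _).comp measurable_snd)))
      (fun r => hpos _ _ r.adj)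
      (fun _ _ _ h => if_pos h) fun _ _ _ h => if_neg h
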